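/- Let $s\in(0,\frac12)\cup(\frac12,1)$, $\alpha\in(\max(0,2s-1),1]$, $L>0$, $\delta>0$ and $n\in\{1,2\}$. Put $\Omega_n=[-L,L]^n$ and $\Omega_n^\delta=(-L-\delta,L+\delta)^n$. The integral fractional Laplacian is $$(-\Delta)^su(\mathbf x)=c_{n,s}\,\mathrm{P.V.}\!\int_{\mathbb R^n}\frac{u(\mathbf x)-u(\mathbf y)}{|\mathbf x-\mathbf y|^{n+2s}}\,d\mathbf y,\qquad c_{n,s}=\frac{2^{2s}s\,\Gamma(n/2+s)}{\pi^{n/2}\Gamma(1-s)},$$ and for $s'<0$ we write $$(-\Delta)^{s'}v(\mathbf x)=c_{n,s'}\int_{\mathbb R^n}|\mathbf x-\mathbf y|^{-2s'-n}v(\mathbf y)\,d\mathbf y,\qquad c_{n,s'}=-\frac{2^{2s'}s'\,\Gamma(n/2+s')}{\pi^{n/2}\Gamma(1-s')}.$$ For an integer $N\ge1$ let $h=2L/N$, $x_i=-L+ih$ $(i\in\mathbb Z)$, with nodes $\mathbf x_{\mathbf i}=x_i$ for $n=1$ and $\mathbf x_{\mathbf i}=(x_i,x_j)$, $\mathbf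 i=(i,j)$, for $n=2$. Let $\bar\phi(y)=\max(1-|y|/h,0)$. Given $u:\mathbb R^n\to\mathbb R$, let $\mathbb I_nu=u$ outside $\Omega_n$, while in $\Omega_n$ it is the piecewise (multi)linear interpolant of $u$: $\mathbb I_1u(x)=\sum_{i=0}^Nu(x_i)\bar\phi(x-x_i)$ and $\mathbb I_2u(x,y)=\sum_{i,j=0}^Nu(x_i,x_j)\bar\phi(x-x_i)\bar\phi(y-x_j)$. Put $v_{\mathbf i}=\big((-\Delta)^{s-1}\mathbb I_nu\big)(\mathbf x_{\mathbf i})$. The scheme is, for $n=1$, $$(-\Delta)_h^su_i=-\frac{v_{i-1}-2v_i+v_{i+1}}{h^2},$$ and for $n=2$, with a parameter $\theta\in[0,1]$, $$(-\Delta)_h^su_{i,j}=-\theta\,\frac{v_{i-1,j}+v_{i+1,j}+v_{i,j-1}+v_{i,j+1}-4v_{i,j}}{h^2}-(1-\theta)\,\frac{v_{i-1,j-1}+v_{i+1,j-1}+v_{i-1,j+1}+v_{i+1,j+1}-4v_{i,j}}{2h^2}.$$ For grid functions $e$ on the interior nodes (all indices in $\{1,\dots,N-1\}$) let $\|e\|_\infty=\max_{\mathbf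 i}|e_{\mathbf i}|$ and $\|e\|_2=\big(h^n\sum_{\mathbf i}|e_{\mathbf i}|^2\big)^{1/2}$. Then there is a constant $C>0$ depending only on $n,s,\alpha,L,\delta$ such that, for every $N\ge1$ with $4h<\delta$, every $\theta\in[0,1]$ (if $n=2$), and every $u\in L^\infty(\mathbb R^n)$ with bounded support and $u\in C^{1,\alpha}(\overline{\Omega_n^\delta})$, the principal value defining $(-\Delta)^su$ exists at all interior nodes, and the truncation error $e_{\mathbf i}=(-\Delta)^su(\mathbf x_{\mathbf i})-(-\Delta)^s_hu_{\mathbf i}$ satisfies $$\|e\|_\infty\le C\,K_u\,h^{1+\alpha-2s},\qquad \|e\|_2\le C\,K_u\,h^{1+\alpha-2s},\qquad K_u=\|u\|_{C^{1,\alpha}(\overline{\Omega_n^\delta})}+\|u\|_{L^\infty(\mathbb R^n)}.$$ -/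

import Mathlib

open MeasureTheory Filter Topology
open scoped ENNReal

noncomputable section

namespace FracFD

section Operators

variable {E : Type*} [NormedAddCommGroup E] [InnerProductSpace ℝ E]

/-- The constant `c_{n,s} = 2^{2s} s Γ(n/2+s) / (π^{n/2} Γ(1-s))`, for `s > 0`. -/
def lapConst (n : ℕ) (s : ℝ) : ℝ :=
  (2 : ℝ) ^ (2 * s) * s * Real.Gamma (n / 2 + s)
    / (Real.pi ^ ((n : ℝ) / 2) * Real.Gamma (1 - s))

/-- The constant `c_{n,s'} = - 2^{2s'} s' Γ(n/2+s') / (π^{n/2} Γ(1-s'))`, for `s' < 0`. -/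
def rieszConst (n : ℕ) (s' : ℝ) : ℝ :=
  -((2 : ℝ) ^ (2 * s') * s' * Real.Gamma (n / 2 + s')
    / (Real.pi ^ ((n : ℝ) / 2) * Real.Gamma (1 - s')))

/-- The integrand `(u x - u y) / |x - y|^{n+2s}` of the integral fractional Laplacian,
`n` being the dimension of the space. -/
def lapIntegrand (s : ℝ) (u : E → ℝ) (x y : E) : ℝ :=
  (u x - u y) / ‖x - y‖ ^ ((Module.finrank ℝ E : ℝ) + 2 * s)

/-- The truncated integral `c_{n,s} ∫_{|x-y|>ε} (u x - u y) / |x - y|^{n+2s} dy`. -/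
def truncLap [MeasureSpace E] (s : ℝ) (u : E → ℝ) (x : E) (ε : ℝ) : ℝ :=
  lapConst (Module.finrank ℝ E) s * ∫ y in {y : E | ε < ‖x - y‖}, lapIntegrand s u x y

/-- The principal value defining `(-Δ)^s u (x)` exists and equals `v`. -/
def HasFracLap [MeasureSpace E] (s : ℝ) (u : E → ℝ) (x : E) (v : ℝ) : Prop :=
  (∀ ε : ℝ, 0 < ε → IntegrableOn (lapIntegrand s u x) {y : E | ε < ‖x - y‖}) ∧
    Tendsto (truncLap s u x) (𝓝[>] 0) (𝓝 v)

/-- The integral fractional Laplacian `(-Δ)^s u (x)`, `0 < s < 1`, as a principal value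
(meaningful where `HasFracLap s u x` holds for some value). -/
def fracLap [MeasureSpace E] (s : ℝ) (u : E → ℝ) (x : E) : ℝ :=
  limUnder (𝓝[>] 0) (truncLap s u x)

/-- The Riesz potential `(-Δ)^{s'} u (x) = c_{n,s'} ∫ |x-y|^{-2s'-n} u(y) dy`, `s' < 0`. -/
def riesz [MeasureSpace E] (s' : ℝ) (u : E → ℝ) (x : E) : ℝ :=
  rieszConst (Module.finrank ℝ E) s' *
    ∫ y : E, ‖x - y‖ ^ (-2 * s' - (Module.finrank ℝ E : ℝ)) * u y

/-- The norm of `C^{1,α}(closure U)`, `U` open: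
`sup_U |u| + sup_U |Du| + [Du]_{α;U}`, with values in `[0,∞]`. -/
def c1HolderNorm (α : ℝ) (U : Set E) (u : E → ℝ) : ℝ≥0∞ :=
  (⨆ x ∈ U, ‖u x‖ₑ) + (⨆ x ∈ U, ‖fderiv ℝ u x‖ₑ)
    + eHolderNorm α.toNNReal (U.domRestrict (fderiv ℝ u))

/-- `u ∈ C^{1,α}(closure U)`, `U` open: `u` is `C^1` in `U` with finite `C^{1,α}` norm (so that
`u` and `Du` extend continuously from `U` to `closure U`, with the same norm). -/
def IsC1Holder (α : ℝ) (U : Set E) (u : E → ℝ) : Prop :=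
  ContDiffOn ℝ 1 u U ∧ c1HolderNorm α U u < ⊤

end Operators

/-- `‖u‖_{C^{1,α}(closure U)} + ‖u‖_{L^∞}` (both are finite where it is used). -/
def dataNorm {E : Type*} [NormedAddCommGroup E] [InnerProductSpace ℝ E] [MeasureSpace E]
    (α : ℝ) (U : Set E) (u : E → ℝ) : ℝ :=
  (c1HolderNorm α U u).toReal + (eLpNorm u ⊤ volume).toReal

/-- The mesh size `h = 2L/N`. -/
def mesh (L : ℝ) (N : ℕ) : ℝ := 2 * L / N

/-- The nodes `x_i = -L + i h`. -/
def node (L : ℝ) (N : ℕ) (i : ℤ) : ℝ := -L + i * mesh L N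

/-- The hat function `1 - |y|/h` on `(-h,h)`, and `0` elsewhere. -/
def hat (h y : ℝ) : ℝ := if |y| < h then 1 - |y| / h else 0

/-- The discrete `l^∞` norm of a grid function on a finite index set. -/
def gridSupNorm {ι : Type*} (I : Finset ι) (e : ι → ℝ) : ℝ := ⨆ i : I, |e i|

/-- The discrete `l²` norm `(h^n ∑ e_i²)^{1/2}` of a grid function on an `n`-dimensional
grid of mesh size `h`. -/
def gridL2Norm {ι : Type*} (n : ℕ) (h : ℝ) (I : Finset ι) (e : ι → ℝ) : ℝ :=
  Real.sqrt (h ^ n * ∑ i ∈ I, e i ^ 2)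

/-! ### One dimension -/

/-- `Ω_1 = [-L,L]`. -/
def dom1 (L : ℝ) : Set ℝ := Set.Icc (-L) L

/-- `Ω_1^δ = (-L-δ, L+δ)`. -/
def box1 (L δ : ℝ) : Set ℝ := Set.Ioo (-L - δ) (L + δ)

/-- The Lagrange basis function `φ_i`, supported in `I_i = [x_{i-1},x_{i+1}] ∩ Ω_1`. -/
def basis1 (L : ℝ) (N : ℕ) (i : ℤ) : ℝ → ℝ :=
  (Set.Icc (node L N (i - 1)) (node L N (i + 1)) ∩ dom1 L).indicator
    fun x => hat (mesh L N) (x - node L N i)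

/-- The interpolant `∑_{i=0}^N u(x_i) φ_i + g`, where `g` is `u` outside `Ω_1` and `0` in `Ω_1`. -/
def interp1 (L : ℝ) (N : ℕ) (u : ℝ → ℝ) (x : ℝ) : ℝ :=
  ∑ i ∈ Finset.Icc (0 : ℤ) N, u (node L N i) * basis1 L N i x + (dom1 L)ᶜ.indicator u x

/-- `-(v_{i-1} - 2 v_i + v_{i+1}) / h²`. -/
def negLap1 (h : ℝ) (v : ℤ → ℝ) (i : ℤ) : ℝ :=
  -((v (i - 1) - 2 * v i + v (i + 1)) / h ^ 2)

/-- The grid function `(-Δ)_h^{s-1} u (x_i)`: the Riesz potential of the interpolant. -/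
def riesz1 (s L : ℝ) (N : ℕ) (u : ℝ → ℝ) (i : ℤ) : ℝ :=
  riesz (s - 1) (interp1 L N u) (node L N i)

/-- The one-dimensional scheme `(-Δ)_h^s u_i`. -/
def scheme1 (s L : ℝ) (N : ℕ) (u : ℝ → ℝ) (i : ℤ) : ℝ :=
  negLap1 (mesh L N) (riesz1 s L N u) i

/-- The truncation error `((-Δ)^s - (-Δ)_h^s) u_i`. -/
def error1 (s L : ℝ) (N : ℕ) (u : ℝ → ℝ) (i : ℤ) : ℝ :=
  fracLap s u (node L N i) - scheme1 s L N u i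

/-- The indices `0 < i < N` of the interior nodes. -/
def interior1 (N : ℕ) : Finset ℤ := Finset.Ioo 0 (N : ℤ)

/-! ### Two dimensions -/

/-- The Euclidean plane. -/
abbrev Plane : Type := EuclideanSpace ℝ (Fin 2)

/-- `Ω_2 = [-L,L] × [-L,L]`. -/
def dom2 (L : ℝ) : Set Plane := {x | ∀ k, x k ∈ Set.Icc (-L) L}

/-- `Ω_2^δ = (-L-δ, L+δ)²`. -/
def box2 (L δ : ℝ) : Set Plane := {x | ∀ k, x k ∈ Set.Ioo (-L - δ) (L + δ)}

/-- The nodes `(x_i, y_j) = (-L + i h, -L + j h)`. -/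
def node2 (L : ℝ) (N : ℕ) (i : ℤ × ℤ) : Plane := !₂[node L N i.1, node L N i.2]

/-- The bilinear Lagrange basis function `φ_{i,j}`, supported in
`I_{i,j} = [x_{i-1},x_{i+1}] × [y_{j-1},y_{j+1}] ∩ Ω_2`. -/
def basis2 (L : ℝ) (N : ℕ) (i : ℤ × ℤ) : Plane → ℝ :=
  ({x : Plane | x 0 ∈ Set.Icc (node L N (i.1 - 1)) (node L N (i.1 + 1)) ∧
      x 1 ∈ Set.Icc (node L N (i.2 - 1)) (node L N (i.2 + 1))} ∩ dom2 L).indicator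
    fun x => hat (mesh L N) (x 0 - node L N i.1) * hat (mesh L N) (x 1 - node L N i.2)

/-- The interpolant `∑_{i,j=0}^N u(x_i,y_j) φ_{i,j} + g`, where `g` is `u` outside `Ω_2` and
`0` in `Ω_2`. -/
def interp2 (L : ℝ) (N : ℕ) (u : Plane → ℝ) (x : Plane) : ℝ :=
  ∑ i ∈ Finset.Icc (0 : ℤ) N ×ˢ Finset.Icc (0 : ℤ) N, u (node2 L N i) * basis2 L N i x
    + (dom2 L)ᶜ.indicator u x

/-- The five-point discrete Laplacian `(-Δ)_{h,1}`. -/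
def negLap2a (h : ℝ) (v : ℤ × ℤ → ℝ) (i : ℤ × ℤ) : ℝ :=
  -((v (i.1 - 1, i.2) + v (i.1 + 1, i.2) + v (i.1, i.2 + 1) + v (i.1, i.2 - 1) - 4 * v i) / h ^ 2)

/-- The diagonal discrete Laplacian `(-Δ)_{h,2}`. -/
def negLap2b (h : ℝ) (v : ℤ × ℤ → ℝ) (i : ℤ × ℤ) : ℝ :=
  -((v (i.1 - 1, i.2 - 1) + v (i.1 + 1, i.2 - 1) + v (i.1 - 1, i.2 + 1) + v (i.1 + 1, i.2 + 1)
      - 4 * v i) / (2 * h ^ 2))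

/-- The grid function `(-Δ)_h^{s-1} u (x_i,y_j)`: the Riesz potential of the interpolant. -/
def riesz2 (s L : ℝ) (N : ℕ) (u : Plane → ℝ) (i : ℤ × ℤ) : ℝ :=
  riesz (s - 1) (interp2 L N u) (node2 L N i)

/-- The two-dimensional scheme `θ (-Δ)_{h,1}^s + (1-θ) (-Δ)_{h,2}^s`. -/
def scheme2 (s θ L : ℝ) (N : ℕ) (u : Plane → ℝ) (i : ℤ × ℤ) : ℝ :=
  θ * negLap2a (mesh L N) (riesz2 s L N u) i + (1 - θ) * negLap2b (mesh L N) (riesz2 s L N u) i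

/-- The truncation error `((-Δ)^s - (-Δ)_h^s) u_{i,j}`. -/
def error2 (s θ L : ℝ) (N : ℕ) (u : Plane → ℝ) (i : ℤ × ℤ) : ℝ :=
  fracLap s u (node2 L N i) - scheme2 s θ L N u i

/-- The indices `0 < i, j < N` of the interior nodes. -/
def interior2 (N : ℕ) : Finset (ℤ × ℤ) := Finset.Ioo 0 (N : ℤ) ×ˢ Finset.Ioo 0 (N : ℤ)

end FracFD

end

/-!
Write `n` for the dimension, `p = 2 - 2 s - n` and `k z = ‖z‖ ^ p`, so that `(-Δ)^{s-1}` is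
convolution with a multiple of `k`, and let `Δ_h` be the discrete Laplacian of the scheme. The proof
moves `Δ_h` from the Riesz potential onto the kernel and treats dimensions one and two, and the two
plane stencils, at once: a stencil enters only through the consistency conditions `IsConsistent`.

* `Δ_h k` is integrable with integral zero (`integral_discLap_norm_rpow`), because the second
  difference with step `2 e` is a sum of four translates of the one with step `e`, while by
  homogeneity its integral is `2 ^ (2 - 2 s) ≠ 4` times the other.
* `T_h = Δ_h k - p (p + n - 2) ‖z‖ ^ (p - 2)` is `O(‖z‖ ^ (p - 4))` at infinity
  (`kernelDefect_decay`), so `|T_h| ‖z‖ ^ β` is integrable for `2 s < β ≤ 2`, and the constants of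
  the fractional Laplacian and of the Riesz potential match: `c_{n,s} = p (p + n - 2) c_{n,s-1}`
  (`lapConst_eq_rieszConst`).
* With `W z = u (x + z) + u (x - z) - 2 u x`, evenness and the zero mean of `Δ_h k` express both
  operators through symmetric differences: twice the error at a node `x` is `c_{n,s-1}` times
  `∫ T_h W + ∫ Δ_h k (W_I - W)`, where `W_I` is the same expression for the interpolant, which
  agrees with `u` at the node `x`.

If `u ∈ C^{1,α}` near the domain and `u` is bounded, then `|W z| ≤ C K_u ‖z‖ ^ (1 + α)` for almost
every `z` in the whole space (`IsC1Holder.ae_abs_symm_le`), and the interpolation error is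
`O(K_u h ^ (1 + α))` (`IsC1Holder.abs_interpolation_le`). Since `Δ_h k` and `T_h` are homogeneous
under simultaneous scaling of `z` and `h`, each of the two integrals is at most
`C K_u h ^ (1 + α - 2 s)` (`exists_truncation_error_bound`).
-/

noncomputable section

namespace FracFD

/-! ### Second differences of powers of the norm -/

/-- The binomial expansion up to order three. Only its first three coefficients matter: in a
symmetric second difference the cubic terms cancel to the order of the remainder. -/
theorem rpow_one_add_expansion (m : ℝ) : ∃ c η M : ℝ, 0 < η ∧ η < 1 ∧ 0 ≤ M ∧ ∀ x : ℝ, |x| ≤ η →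
    |(1 + x) ^ m - (1 + m * x + m * (m - 1) / 2 * x ^ 2 + c * x ^ 3)| ≤ M * x ^ 4 := by
  have h := (Real.one_add_rpow_hasFPowerSeriesAt_zero (a := m)).isBigO_sub_partialSum_pow 4
  obtain ⟨M, hM, h⟩ := h.exists_nonneg
  rw [Asymptotics.isBigOWith_iff, Metric.eventually_nhds_iff] at h
  obtain ⟨ε, hε, h⟩ := h
  have h2 : Ring.choose m 2 = m * (m - 1) / 2 := by
    have := Ring.descPochhammer_eq_factorial_smul_choose m 2
    simp [descPochhammer_succ_right, Polynomial.smeval_mul, Polynomial.smeval_sub,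
      Nat.factorial] at this
    linarith
  refine ⟨Ring.choose m 3, min (ε / 2) (1 / 2), M, by positivity, ?_, hM, fun x hx => ?_⟩
  · exact (min_le_right _ _).trans_lt (by norm_num)
  · have hx' : dist x 0 < ε := by
      rw [dist_zero_right, Real.norm_eq_abs]
      exact (hx.trans (min_le_left _ _)).trans_lt (by linarith)
    have := h hx'
    simp only [zero_add, FormalMultilinearSeries.partialSum, Finset.sum_range_succ,
      Finset.sum_range_zero, binomialSeries_apply, h2] at this
    simp only [Real.norm_eq_abs] at this
    convert this using 2
    · simp
      ring
    · rw [abs_of_nonneg (by positivity), Even.pow_abs (by decide)]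

theorem norm_rpow_factor {E : Type*} [NormedAddCommGroup E] (p : ℝ) {z w : E} (x : ℝ)
    (hx : 0 ≤ 1 + x)
    (h : ‖w‖ ^ 2 = ‖z‖ ^ 2 * (1 + x)) : ‖w‖ ^ p = ‖z‖ ^ p * (1 + x) ^ (p / 2) := by
  have key (a : ℝ) (ha : 0 ≤ a) : a ^ p = (a ^ 2) ^ (p / 2) := by
    rw [← Real.rpow_natCast_mul ha]; congr 1; push_cast; ring
  rw [key _ (norm_nonneg w), h, Real.mul_rpow (by positivity) hx, ← key _ (norm_nonneg z)]

section Kernel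

variable {E : Type*} [NormedAddCommGroup E] [InnerProductSpace ℝ E]

/-- The symmetric second difference `f (z + e) + f (z - e) - 2 f z`. -/
def secondDiff (f : E → ℝ) (e z : E) : ℝ := f (z + e) + f (z - e) - 2 * f z

/-- The second difference of `‖z‖ ^ p` is its second derivative in direction `e` up to
`O(‖z‖ ^ (p - 4))`; the third-order terms cancel by symmetry. With `A = ‖z‖ ^ 2`, this is the
expansion of `(1 + (± 2 ⟪z, e⟫ + ‖e‖ ^ 2) / A) ^ (p / 2)`. -/
theorem secondDiff_norm_rpow_expansion (p : ℝ) (e : E) :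
    ∃ R M : ℝ, 1 ≤ R ∧ 0 ≤ M ∧ ∀ z : E, R ≤ ‖z‖ →
    |secondDiff (fun z => ‖z‖ ^ p) e z - ‖z‖ ^ (p - 2) *
      (p * ‖e‖ ^ 2 + p * (p - 2) * (inner ℝ z e ^ 2 / ‖z‖ ^ 2))| ≤ M * ‖z‖ ^ (p - 4) := by
  obtain ⟨c, η, M, hη, hη1, hM, h⟩ := rpow_one_add_expansion (p / 2)
  set a := ‖e‖ with ha
  have ha0 : 0 ≤ a := norm_nonneg _
  set κ := 2 * a + a ^ 2 with hκ
  have hκ0 : 0 ≤ κ := by positivity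
  set m := p / 2 with hm
  refine ⟨max 1 (κ / η), |m * (m - 1)| * a ^ 4 + |c| * (2 * a ^ 6 + 24 * a ^ 4) + 2 * M * κ ^ 4,
    le_max_left _ _, by positivity, fun z hz => ?_⟩
  set r := ‖z‖ with hr
  have hr1 : 1 ≤ r := (le_max_left _ _).trans hz
  have hr0 : 0 < r := by linarith
  have hrη : κ / r ≤ η := by
    rw [div_le_iff₀ hr0, ← div_le_iff₀' hη]; exact (le_max_right _ _).trans hz
  set B : ℝ := inner ℝ z e with hB
  have hBa : |B| ≤ r * a := abs_real_inner_le_norm z e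
  have hB2 : B ^ 2 ≤ a ^ 2 * r ^ 2 := by
    rw [← sq_abs]; nlinarith [abs_nonneg B, mul_nonneg hr0.le ha0]
  have bound (t : ℝ) (ht : |t| = |B|) : |(2 * t + a ^ 2) / r ^ 2| ≤ κ / r := by
    rw [abs_div, abs_of_pos (by positivity : 0 < r ^ 2), div_le_div_iff₀ (by positivity) hr0]
    have h1 : |2 * t + a ^ 2| ≤ 2 * (r * a) + a ^ 2 := by
      refine (abs_add_le _ _).trans ?_
      rw [abs_mul, ht, abs_of_nonneg (by positivity : (0:ℝ) ≤ a ^ 2), abs_two]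
      linarith
    have h2 : 2 * (r * a) + a ^ 2 ≤ κ * r := by
      have : a ^ 2 ≤ a ^ 2 * r := le_mul_of_one_le_right (by positivity) hr1
      rw [hκ]; linarith
    calc _ ≤ (κ * r) * r := by gcongr; exact h1.trans h2
      _ = _ := by ring
  set x := (2 * B + a ^ 2) / r ^ 2 with hx
  set y := (2 * (-B) + a ^ 2) / r ^ 2 with hy
  have hxb := bound B rfl
  have hyb := bound (-B) (abs_neg B)
  have hx1 : 0 ≤ 1 + x := by have := abs_le.1 (hxb.trans hrη); linarith
  have hy1 : 0 ≤ 1 + y := by have := abs_le.1 (hyb.trans hrη); linarith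
  have e1 : ‖z + e‖ ^ p = r ^ p * (1 + x) ^ m := by
    apply norm_rpow_factor p x hx1
    rw [norm_add_sq_real, ← hB, ← hr, ← ha, hx]; field_simp; ring
  have e2 : ‖z - e‖ ^ p = r ^ p * (1 + y) ^ m := by
    apply norm_rpow_factor p y hy1
    rw [norm_sub_sq_real, ← hB, ← hr, ← ha, hy]; field_simp; ring
  have e3 : r ^ (p - 2) = r ^ p / r ^ 2 := by rw [Real.rpow_sub hr0]; norm_cast
  have e4 : r ^ (p - 4) = r ^ p / r ^ 4 := by rw [Real.rpow_sub hr0]; norm_cast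
  have hTx := h x (hxb.trans hrη)
  have hTy := h y (hyb.trans hrη)
  have hx4 : x ^ 4 ≤ κ ^ 4 / r ^ 4 := by
    rw [← div_pow, ← Even.pow_abs (by decide : Even 4)]; gcongr
  have hy4 : y ^ 4 ≤ κ ^ 4 / r ^ 4 := by
    rw [← div_pow, ← Even.pow_abs (by decide : Even 4)]; gcongr
  set tx := (1 + x) ^ m - (1 + m * x + m * (m - 1) / 2 * x ^ 2 + c * x ^ 3) with htx
  set ty := (1 + y) ^ m - (1 + m * y + m * (m - 1) / 2 * y ^ 2 + c * y ^ 3) with hty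
  -- The terms of order `r ^ (p - 3)` are odd in `e` and cancel; what is left is `O(r ^ (p - 4))`.
  have main : secondDiff (fun z => ‖z‖ ^ p) e z - r ^ (p - 2) *
      (p * a ^ 2 + p * (p - 2) * (B ^ 2 / r ^ 2)) = r ^ p * (tx + ty +
        m * (m - 1) * (a ^ 4 / r ^ 4) + c * ((2 * a ^ 6 + 24 * a ^ 2 * B ^ 2) / r ^ 6)) := by
    have hp : p = 2 * m := by rw [hm]; ring
    have ex : (1 + x) ^ m = tx + (1 + m * x + m * (m - 1) / 2 * x ^ 2 + c * x ^ 3) := by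
      rw [htx]; ring
    have ey : (1 + y) ^ m = ty + (1 + m * y + m * (m - 1) / 2 * y ^ 2 + c * y ^ 3) := by
      rw [hty]; ring
    simp only [secondDiff]
    rw [e1, e2, e3, ex, ey, ← hr]
    generalize r ^ p = q
    rw [hp, hx, hy]
    clear_value tx ty
    field_simp
    ring
  rw [main, e4, abs_mul, abs_of_pos (Real.rpow_pos_of_pos hr0 p)]
  have f2 : |m * (m - 1) * (a ^ 4 / r ^ 4)| = |m * (m - 1)| * a ^ 4 / r ^ 4 := by
    rw [abs_mul, abs_of_nonneg (by positivity : 0 ≤ a ^ 4 / r ^ 4)]; ring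
  have f3 : |c * ((2 * a ^ 6 + 24 * a ^ 2 * B ^ 2) / r ^ 6)|
      ≤ |c| * (2 * a ^ 6 + 24 * a ^ 4) / r ^ 4 := by
    rw [abs_mul, abs_of_nonneg (by positivity : 0 ≤ (2 * a ^ 6 + 24 * a ^ 2 * B ^ 2) / r ^ 6),
      mul_div_assoc]
    gcongr ?_ * ?_
    rw [div_le_div_iff₀ (by positivity) (by positivity)]
    have : 2 * a ^ 6 + 24 * a ^ 2 * B ^ 2 ≤ (2 * a ^ 6 + 24 * a ^ 4) * r ^ 2 := by
      have i1 : a ^ 6 ≤ a ^ 6 * r ^ 2 := le_mul_of_one_le_right (by positivity) (one_le_pow₀ hr1)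
      have i2 : a ^ 2 * B ^ 2 ≤ a ^ 2 * (a ^ 2 * r ^ 2) := by gcongr
      linarith
    calc _ ≤ (2 * a ^ 6 + 24 * a ^ 4) * r ^ 2 * r ^ 4 := by gcongr
      _ = _ := by ring
  have : |tx + ty + m * (m - 1) * (a ^ 4 / r ^ 4) +
      c * ((2 * a ^ 6 + 24 * a ^ 2 * B ^ 2) / r ^ 6)| ≤
      (|m * (m - 1)| * a ^ 4 + |c| * (2 * a ^ 6 + 24 * a ^ 4) + 2 * M * κ ^ 4) / r ^ 4 := by
    refine (abs_add_le _ _).trans ((add_le_add (abs_add_le _ _) le_rfl).trans ?_)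
    have g1 := abs_add_le tx ty
    have g2 := mul_le_mul_of_nonneg_left hx4 hM
    have g3 := mul_le_mul_of_nonneg_left hy4 hM
    have : (|m * (m - 1)| * a ^ 4 + |c| * (2 * a ^ 6 + 24 * a ^ 4) + 2 * M * κ ^ 4) / r ^ 4 =
      |m * (m - 1)| * a ^ 4 / r ^ 4 + |c| * (2 * a ^ 6 + 24 * a ^ 4) / r ^ 4 +
        2 * (M * (κ ^ 4 / r ^ 4)) := by ring
    linarith
  calc _ ≤ r ^ p * _ := mul_le_mul_of_nonneg_left this (by positivity)
    _ = _ := by ring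

theorem secondDiff_norm_rpow_smul (p : ℝ) {h : ℝ} (hh : 0 ≤ h) (e z : E) :
    secondDiff (fun z : E => ‖z‖ ^ p) (h • e) (h • z) =
      h ^ p * secondDiff (fun z : E => ‖z‖ ^ p) e z := by
  have key (w : E) : ‖h • w‖ ^ p = h ^ p * ‖w‖ ^ p := by
    rw [norm_smul, Real.norm_of_nonneg hh, Real.mul_rpow hh (norm_nonneg _)]
  simp only [secondDiff, ← smul_add, ← smul_sub, key]
  ring

/-- A second difference with the double step is a combination of three translates of the single
one, with weights of sum `4`. -/
theorem secondDiff_two_smul (f : E → ℝ) (e z : E) :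
    secondDiff f ((2 : ℝ) • e) z =
      secondDiff f e (z + e) + 2 * secondDiff f e z + secondDiff f e (z - e) := by
  have h1 : z + e + e = z + (2 : ℝ) • e := by rw [two_smul]; abel
  have h2 : z - e - e = z - (2 : ℝ) • e := by rw [two_smul]; abel
  simp only [secondDiff, h1, h2, add_sub_cancel_right, sub_add_cancel]
  ring

end Kernel

/-! ### Integrability and vanishing mean of the second differences -/

section RieszKernel

variable {E : Type*} [NormedAddCommGroup E] [InnerProductSpace ℝ E] [FiniteDimensional ℝ E]
  [MeasureSpace E] [BorelSpace E] [(volume : Measure E).IsAddHaarMeasure]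

local notation "dim" => (Module.finrank ℝ E : ℝ)

theorem integrableOn_norm_rpow_compl_ball {p : ℝ} (hp : p < -dim) {r : ℝ} (hr : 0 < r) :
    IntegrableOn (fun z : E => ‖z‖ ^ p) (Metric.ball 0 r)ᶜ := by
  have h := (integrable_one_add_norm (μ := (volume : Measure E)) (r := -p) (by linarith)).const_mul
    (((r⁻¹ + 1)⁻¹) ^ p)
  refine Integrable.mono' h.integrableOn (measurable_norm.pow_const p).aestronglyMeasurable ?_
  filter_upwards [ae_restrict_mem Metric.isOpen_ball.measurableSet.compl] with z hz
  have hz : r ≤ ‖z‖ := by simpa using hz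
  rw [neg_neg, Real.norm_of_nonneg (by positivity), ← Real.mul_rpow (by positivity) (by positivity)]
  refine Real.rpow_le_rpow_of_nonpos (by positivity) ?_ ?_
  · rw [inv_mul_le_iff₀ (by positivity), add_mul, one_mul]
    have : 1 ≤ r⁻¹ * ‖z‖ := by rw [← div_eq_inv_mul, le_div_iff₀ hr]; linarith
    linarith
  · have : (0 : ℝ) ≤ dim := by positivity
    linarith

theorem integrable_of_integrableOn_ball_of_decay {f : E → ℝ} (hf : AEStronglyMeasurable f)
    {R M q : ℝ} (hR : 0 < R) (hq : q < -dim) (h1 : IntegrableOn f (Metric.ball 0 R))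
    (h2 : ∀ z, R ≤ ‖z‖ → |f z| ≤ M * ‖z‖ ^ q) : Integrable f := by
  rw [← integrableOn_univ, ← Set.union_compl_self (Metric.ball (0 : E) R)]
  refine h1.union (Integrable.mono' ((integrableOn_norm_rpow_compl_ball hq hR).const_mul M)
    hf.restrict ?_)
  filter_upwards [ae_restrict_mem Metric.isOpen_ball.measurableSet.compl] with z hz
  exact h2 z (by simpa using hz)

variable [Nontrivial E]

theorem integrableOn_norm_rpow_ball {p : ℝ} (hp : -dim < p) (r : ℝ) :
    IntegrableOn (fun z : E => ‖z‖ ^ p) (Metric.ball 0 r) := by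
  refine integrableOn_ball_of_norm_le_rpow (α := -p) (C := 1) (Module.finrank_pos (R := ℝ))
    (by linarith) (Eventually.of_forall fun z => ?_) ?_
  · rw [neg_neg, one_mul, Real.norm_of_nonneg (by positivity)]
  · exact (measurable_norm.pow_const p).aestronglyMeasurable

theorem integrableOn_norm_add_rpow_ball {p : ℝ} (hp : -dim < p) (e : E) (R : ℝ) :
    IntegrableOn (fun z : E => ‖z + e‖ ^ p) (Metric.ball 0 R) := by
  have h := (measurePreserving_add_right (volume : Measure E) e).integrableOn_comp_preimage
    (MeasurableEquiv.addRight e).measurableEmbedding (f := fun z : E => ‖z‖ ^ p)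
    (s := Metric.ball 0 (R + ‖e‖))
  refine IntegrableOn.mono_set (h.2 (integrableOn_norm_rpow_ball hp _)) fun z hz => ?_
  have hz : ‖z‖ < R := by simpa using hz
  rw [Set.mem_preimage, mem_ball_zero_iff]
  exact (norm_add_le z e).trans_lt (by linarith)

theorem integrable_norm_add_rpow_mul {p : ℝ} (hp : -dim < p) (e : E) {g : E → ℝ}
    (hg : AEStronglyMeasurable g) {R M : ℝ} (hM : ∀ᵐ z, |g z| ≤ M)
    (hsupp : ∀ z, R ≤ ‖z‖ → g z = 0) : Integrable fun z : E => ‖z + e‖ ^ p * g z := by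
  have h : IntegrableOn (fun z : E => ‖z + e‖ ^ p * g z) (Metric.ball 0 R) :=
    (integrableOn_norm_add_rpow_ball hp e R).mul_bdd hg.restrict (ae_restrict_of_ae hM)
  refine h.integrable_of_forall_notMem_eq_zero fun z hz => ?_
  rw [hsupp z (by simpa using hz), mul_zero]

theorem measurable_secondDiff_norm_rpow {E : Type*} [NormedAddCommGroup E] [MeasurableSpace E]
    [BorelSpace E] (p : ℝ) (e : E) :
    Measurable (secondDiff (fun z : E => ‖z‖ ^ p) e) := by
  unfold secondDiff
  fun_prop

/-- The singularity at `0` is integrable because `-n < p`, and at infinity the second difference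
decays like `‖z‖ ^ (p - 2)`. -/
theorem integrable_secondDiff_norm_rpow {p : ℝ} (hp : -dim < p) (hp2 : p - 2 < -dim) (e : E) :
    Integrable (secondDiff (fun z : E => ‖z‖ ^ p) e) := by
  obtain ⟨R, M, hR, hM, h⟩ := secondDiff_norm_rpow_expansion p e
  refine integrable_of_integrableOn_ball_of_decay
    (measurable_secondDiff_norm_rpow p e).aestronglyMeasurable (by linarith : 0 < R) hp2
    (M := M + (|p| * ‖e‖ ^ 2 + |p * (p - 2)| * ‖e‖ ^ 2)) ?_ fun z hz => ?_
  · refine ((integrableOn_norm_add_rpow_ball hp e R).add ?_).sub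
      ((integrableOn_norm_rpow_ball hp R).const_mul 2)
    simpa only [sub_eq_add_neg] using integrableOn_norm_add_rpow_ball hp (-e) R
  · have hz1 : 1 ≤ ‖z‖ := hR.trans hz
    have hz0 : 0 < ‖z‖ := by linarith
    have h1 := h z hz
    have h2 : ‖z‖ ^ (p - 4) ≤ ‖z‖ ^ (p - 2) := Real.rpow_le_rpow_of_exponent_le hz1 (by linarith)
    have h3 : |p * ‖e‖ ^ 2 + p * (p - 2) * (inner ℝ z e ^ 2 / ‖z‖ ^ 2)| ≤
        |p| * ‖e‖ ^ 2 + |p * (p - 2)| * ‖e‖ ^ 2 := by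
      refine (abs_add_le _ _).trans (add_le_add ?_ ?_)
      · rw [abs_mul, abs_of_nonneg (by positivity : 0 ≤ ‖e‖ ^ 2)]
      · rw [abs_mul, abs_of_nonneg (by positivity : 0 ≤ inner ℝ z e ^ 2 / ‖z‖ ^ 2)]
        gcongr
        rw [div_le_iff₀ (by positivity), ← sq_abs, ← mul_pow, mul_comm ‖e‖]
        gcongr
        exact abs_real_inner_le_norm z e
    set q := ‖z‖ ^ (p - 2)
    have hq : 0 ≤ q := by positivity
    set t := p * ‖e‖ ^ 2 + p * (p - 2) * (inner ℝ z e ^ 2 / ‖z‖ ^ 2)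
    calc |secondDiff (fun z : E => ‖z‖ ^ p) e z|
        = |(secondDiff (fun z : E => ‖z‖ ^ p) e z - q * t) + q * t| := by ring_nf
      _ ≤ M * q + q * (|p| * ‖e‖ ^ 2 + |p * (p - 2)| * ‖e‖ ^ 2) := by
          refine (abs_add_le _ _).trans (add_le_add (h1.trans (by gcongr)) ?_)
          rw [abs_mul, abs_of_nonneg hq]
          gcongr
      _ = _ := by ring

/-- Doubling the step multiplies the integral by `4`, since a second difference with step `2 e` is
a combination of translates of one with step `e`; by homogeneity it also multiplies it by
`2 ^ (p + n) < 4`. -/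
theorem integral_secondDiff_norm_rpow {p : ℝ} (hp : -dim < p) (hp2 : p - 2 < -dim) (e : E) :
    ∫ z, secondDiff (fun z : E => ‖z‖ ^ p) e z = 0 := by
  set D := secondDiff (fun z : E => ‖z‖ ^ p) e with hD
  have hi : Integrable D := integrable_secondDiff_norm_rpow hp hp2 e
  have h1 : ∫ z, secondDiff (fun z : E => ‖z‖ ^ p) ((2 : ℝ) • e) z = 4 * ∫ z, D z := by
    simp only [secondDiff_two_smul, ← hD]
    have h12 : Integrable fun z => D (z + e) + 2 * D z :=
      (hi.comp_add_right e).add (hi.const_mul 2)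
    rw [integral_add h12 (hi.comp_sub_right e), integral_add (hi.comp_add_right e) (hi.const_mul 2),
      integral_const_mul,
      integral_add_right_eq_self D, integral_sub_right_eq_self D]
    ring
  have h2 := Measure.integral_comp_smul (volume : Measure E)
    (secondDiff (fun z : E => ‖z‖ ^ p) ((2 : ℝ) • e)) 2
  simp only [secondDiff_norm_rpow_smul p zero_le_two e] at h2
  rw [h1, ← hD, integral_const_mul, smul_eq_mul, abs_of_nonneg (by positivity),
    ← Real.rpow_natCast, ← Real.rpow_neg zero_le_two] at h2
  have h3 : ((2 : ℝ) ^ (p + dim) - 4) * ∫ z, D z = 0 := by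
    have : (2 : ℝ) ^ (p + dim) * ∫ z, D z = 2 ^ dim * (2 ^ p * ∫ z, D z) := by
      rw [Real.rpow_add two_pos]; ring
    rw [sub_mul, this, h2, ← mul_assoc, ← Real.rpow_add two_pos]
    simp
  refine (mul_eq_zero.1 h3).resolve_left (sub_ne_zero.2 (ne_of_lt ?_))
  calc (2 : ℝ) ^ (p + dim) < 2 ^ (2 : ℝ) :=
        Real.rpow_lt_rpow_of_exponent_lt one_lt_two (by linarith)
    _ = 4 := by norm_num

end RieszKernel

/-! ### Discrete Laplacians of the Riesz kernel -/

/-- The Laplacian of `rieszConst n (s - 1) * ‖z‖ ^ (2 - 2 s - n)` is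
`lapConst n s * ‖z‖ ^ (-n - 2 s)`. -/
theorem lapConst_eq_rieszConst {n : ℕ} {s : ℝ} (hs : s < 1) (hn : (n : ℝ) / 2 + (s - 1) ≠ 0) :
    lapConst n s = rieszConst n (s - 1) * (2 * s * (n + 2 * s - 2)) := by
  have h1 : Real.Gamma (n / 2 + s) = (n / 2 + (s - 1)) * Real.Gamma (n / 2 + (s - 1)) := by
    rw [← Real.Gamma_add_one hn]; congr 1; ring
  have h2 : Real.Gamma (1 - (s - 1)) = (1 - s) * Real.Gamma (1 - s) := by
    rw [← Real.Gamma_add_one (by linarith)]; congr 1; ring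
  have h3 : (2 : ℝ) ^ (2 * s) = 2 ^ (2 * (s - 1)) * 4 := by
    rw [show 2 * s = 2 * (s - 1) + 2 by ring, Real.rpow_add two_pos]; norm_num
  have h4 : Real.Gamma (1 - s) ≠ 0 := (Real.Gamma_pos_of_pos (by linarith)).ne'
  have h5 : Real.pi ^ ((n : ℝ) / 2) ≠ 0 := (Real.rpow_pos_of_pos Real.pi_pos _).ne'
  have h6 : 1 - s ≠ 0 := by linarith
  unfold lapConst rieszConst
  rw [h1, h2, h3]
  field_simp
  ring

section Stencil

variable {E : Type*} [NormedAddCommGroup E] [InnerProductSpace ℝ E]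
  {J : Type*} [Fintype J]

/-- The discrete Laplacian `h⁻² ∑ a_j (f (z + h e_j) + f (z - h e_j) - 2 f z)`. -/
def discLap (a : J → ℝ) (e : J → E) (h : ℝ) (f : E → ℝ) (z : E) : ℝ :=
  (∑ j, a j * secondDiff f (h • e j) z) / h ^ 2

/-- The consistency conditions making `discLap a e h` a discretisation of the Laplacian. -/
structure IsConsistent (a : J → ℝ) (e : J → E) : Prop where
  sum_inner_sq : ∀ z, ∑ j, a j * inner ℝ z (e j) ^ 2 = ‖z‖ ^ 2
  sum_norm_sq : ∑ j, a j * ‖e j‖ ^ 2 = Module.finrank ℝ E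

/-- The error of the discrete Laplacian on the kernel `‖z‖ ^ p`, whose Laplacian
is `p (p + n - 2) ‖z‖ ^ (p - 2)`. -/
def kernelDefect (a : J → ℝ) (e : J → E) (p h : ℝ) (z : E) : ℝ :=
  discLap a e h (fun z => ‖z‖ ^ p) z - p * (p + Module.finrank ℝ E - 2) * ‖z‖ ^ (p - 2)

theorem discLap_norm_rpow_smul (a : J → ℝ) (e : J → E) (p : ℝ) {h : ℝ} (hh : 0 < h) (z : E) :
    discLap a e h (fun z => ‖z‖ ^ p) (h • z) =
      h ^ (p - 2) * discLap a e 1 (fun z => ‖z‖ ^ p) z := by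
  have h2 : h ^ (p - 2) = h ^ p / h ^ 2 := by rw [Real.rpow_sub hh]; norm_cast
  simp only [discLap, secondDiff_norm_rpow_smul p hh.le, one_smul, h2, mul_left_comm _ (h ^ p),
    ← Finset.mul_sum]
  ring

theorem kernelDefect_smul (a : J → ℝ) (e : J → E) (p : ℝ) {h : ℝ} (hh : 0 < h) (z : E) :
    kernelDefect a e p h (h • z) = h ^ (p - 2) * kernelDefect a e p 1 z := by
  have h1 : ‖h • z‖ ^ (p - 2) = h ^ (p - 2) * ‖z‖ ^ (p - 2) := by
    rw [norm_smul, Real.norm_of_nonneg hh.le, Real.mul_rpow hh.le (norm_nonneg _)]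
  simp only [kernelDefect, discLap_norm_rpow_smul a e p hh, h1]
  ring

theorem discLap_norm_rpow_neg (a : J → ℝ) (e : J → E) (p h : ℝ) (z : E) :
    discLap a e h (fun z => ‖z‖ ^ p) (-z) = discLap a e h (fun z => ‖z‖ ^ p) z := by
  have h1 (w : E) : ‖-z + w‖ = ‖z - w‖ := by rw [← norm_neg]; congr 1; abel
  have h2 (w : E) : ‖-z - w‖ = ‖z + w‖ := by rw [← norm_neg]; congr 1; abel
  simp only [discLap, secondDiff, h1, h2, norm_neg,
    add_comm (‖z - _‖ ^ p)]

/-- Consistency makes the second-order terms of the expansions add up to the Laplacian of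
`‖z‖ ^ p`. -/
theorem kernelDefect_decay {a : J → ℝ} {e : J → E} (hc : IsConsistent a e) (p : ℝ) :
    ∃ R M : ℝ, 1 ≤ R ∧ ∀ z : E, R ≤ ‖z‖ → |kernelDefect a e p 1 z| ≤ M * ‖z‖ ^ (p - 4) := by
  choose R M hR hM h using fun j => secondDiff_norm_rpow_expansion p (e j)
  refine ⟨1 + ∑ j, R j, ∑ j, |a j| * M j, ?_, fun z hz => ?_⟩
  · have : 0 ≤ ∑ j, R j := Finset.sum_nonneg fun j _ => by linarith [hR j]
    linarith
  have hRz (j : J) : R j ≤ ‖z‖ := by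
    have : R j ≤ ∑ j, R j :=
      Finset.single_le_sum (f := R) (fun j _ => by linarith [hR j]) (Finset.mem_univ j)
    linarith
  have hz0 : 0 < ‖z‖ := by
    have : 0 ≤ ∑ j, R j := Finset.sum_nonneg fun j _ => by linarith [hR j]
    linarith
  have key : kernelDefect a e p 1 z = ∑ j, a j * (secondDiff (fun z => ‖z‖ ^ p) (e j) z -
      ‖z‖ ^ (p - 2) * (p * ‖e j‖ ^ 2 + p * (p - 2) * (inner ℝ z (e j) ^ 2 / ‖z‖ ^ 2))) := by
    have : ∑ j, a j * (‖z‖ ^ (p - 2) *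
        (p * ‖e j‖ ^ 2 + p * (p - 2) * (inner ℝ z (e j) ^ 2 / ‖z‖ ^ 2))) =
        ‖z‖ ^ (p - 2) * (p * ∑ j, a j * ‖e j‖ ^ 2 +
          p * (p - 2) / ‖z‖ ^ 2 * ∑ j, a j * inner ℝ z (e j) ^ 2) := by
      rw [Finset.mul_sum, Finset.mul_sum, ← Finset.sum_add_distrib, Finset.mul_sum]
      exact Finset.sum_congr rfl fun j _ => by ring
    rw [Finset.sum_congr rfl fun j _ => mul_sub (a j) _ _, Finset.sum_sub_distrib, this,
      hc.sum_inner_sq, hc.sum_norm_sq, div_mul_cancel₀ _ (by positivity)]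
    simp only [kernelDefect, discLap, one_smul]
    ring
  rw [key, Finset.sum_mul]
  refine (Finset.abs_sum_le_sum_abs _ _).trans (Finset.sum_le_sum fun j _ => ?_)
  rw [abs_mul, mul_assoc |a j|]
  exact mul_le_mul_of_nonneg_left (h j z (hRz j)) (abs_nonneg _)

theorem measurable_discLap_norm_rpow {E : Type*} [NormedAddCommGroup E] [InnerProductSpace ℝ E]
    [MeasurableSpace E] [BorelSpace E] (a : J → ℝ) (e : J → E) (p h : ℝ) :
    Measurable (discLap a e h (fun z => ‖z‖ ^ p)) := by
  unfold discLap
  have := fun j => measurable_secondDiff_norm_rpow p (h • e j)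
  fun_prop

variable [FiniteDimensional ℝ E] [MeasureSpace E] [BorelSpace E]
  [(volume : Measure E).IsAddHaarMeasure]

local notation "dim" => (Module.finrank ℝ E : ℝ)

/-- Scaling of an integral whose integrand is homogeneous of degree `q` jointly in the point and
the step `h`. -/
theorem integral_comp_of_homogeneous {f : E → ℝ → ℝ} {q h : ℝ} (hh : 0 < h)
    (hf : ∀ z, f (h • z) h = h ^ q * f z 1) :
    ∫ z, f z h = h ^ (q + dim) * ∫ z, f z 1 := by
  have h1 := Measure.integral_comp_smul_of_nonneg (volume : Measure E) (fun z => f z h) h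
    (hR := hh.le)
  simp only [hf] at h1
  rw [integral_const_mul, smul_eq_mul, eq_inv_mul_iff_mul_eq₀ (by positivity)] at h1
  rw [← h1, Real.rpow_add hh, Real.rpow_natCast]
  ring

theorem integral_abs_discLap_norm_rpow (a : J → ℝ) (e : J → E) (p : ℝ) {h : ℝ} (hh : 0 < h) :
    ∫ z, |discLap a e h (fun z : E => ‖z‖ ^ p) z| =
      h ^ (p - 2 + dim) * ∫ z, |discLap a e 1 (fun z : E => ‖z‖ ^ p) z| := by
  refine integral_comp_of_homogeneous (f := fun z h => |discLap a e h (fun z : E => ‖z‖ ^ p) z|)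
    hh fun z => ?_
  rw [discLap_norm_rpow_smul a e p hh, abs_mul, abs_of_pos (Real.rpow_pos_of_pos hh _)]

theorem integral_abs_kernelDefect_mul (a : J → ℝ) (e : J → E) (p β : ℝ) {h : ℝ} (hh : 0 < h) :
    ∫ z, |kernelDefect a e p h z| * ‖z‖ ^ β =
      h ^ (p - 2 + β + dim) * ∫ z, |kernelDefect a e p 1 z| * ‖z‖ ^ β := by
  refine integral_comp_of_homogeneous (f := fun z h => |kernelDefect a e p h z| * ‖z‖ ^ β)
    hh fun z => ?_
  rw [kernelDefect_smul a e p hh, abs_mul, abs_of_pos (Real.rpow_pos_of_pos hh _),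
    norm_smul, Real.norm_of_nonneg hh.le, Real.mul_rpow hh.le (norm_nonneg _), Real.rpow_add hh]
  ring

variable [Nontrivial E]

theorem integrable_discLap_norm_rpow (a : J → ℝ) (e : J → E) {p : ℝ} (hp : -dim < p)
    (hp2 : p - 2 < -dim) (h : ℝ) : Integrable (discLap a e h (fun z : E => ‖z‖ ^ p)) :=
  (integrable_finsetSum _ fun j _ =>
    (integrable_secondDiff_norm_rpow hp hp2 (h • e j)).const_mul (a j)).div_const _

theorem integral_discLap_norm_rpow (a : J → ℝ) (e : J → E) {p : ℝ} (hp : -dim < p)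
    (hp2 : p - 2 < -dim) (h : ℝ) : ∫ z, discLap a e h (fun z : E => ‖z‖ ^ p) z = 0 := by
  simp only [discLap]
  rw [integral_div, integral_finsetSum _ fun j _ =>
    (integrable_secondDiff_norm_rpow hp hp2 (h • e j)).const_mul (a j)]
  simp [integral_const_mul, integral_secondDiff_norm_rpow hp hp2]

/-- Near `0` the two parts of the defect are integrable separately, by `-n < p - 2 + β`; at infinity
the fourth-order decay is needed. -/
theorem integrable_kernelDefect_mul {a : J → ℝ} {e : J → E} (hc : IsConsistent a e) {p β h : ℝ}
    (hp : -dim < p) (hp2 : p - 2 < -dim) (hβ0 : 0 ≤ β) (hβ : -dim < p - 2 + β)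
    (hβ2 : p - 4 + β < -dim) (hh : 0 < h) :
    Integrable fun z => |kernelDefect a e p h z| * ‖z‖ ^ β := by
  have h1 : Integrable fun z => |kernelDefect a e p 1 z| * ‖z‖ ^ β := by
    obtain ⟨R, M, hR, hM⟩ := kernelDefect_decay hc p
    have hm : Measurable fun z => kernelDefect a e p 1 z := by
      have := measurable_discLap_norm_rpow a e p 1
      unfold kernelDefect
      fun_prop
    have hR0 : 0 < R := by linarith
    refine integrable_of_integrableOn_ball_of_decay (by fun_prop) hR0 hβ2 (M := M) ?_ fun z hz => ?_
    · have i1 : IntegrableOn (fun z => discLap a e 1 (fun z : E => ‖z‖ ^ p) z * ‖z‖ ^ β)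
          (Metric.ball 0 R) := by
        refine (integrable_discLap_norm_rpow a e hp hp2 1).integrableOn.mul_bdd (c := R ^ β)
          (by fun_prop) ?_
        filter_upwards [ae_restrict_mem Metric.isOpen_ball.measurableSet] with z hz
        have hz : ‖z‖ < R := by simpa using hz
        rw [Real.norm_of_nonneg (by positivity)]
        gcongr
      have i2 := (integrableOn_norm_rpow_ball (E := E) hβ R).const_mul
        (p * (p + Module.finrank ℝ E - 2))
      refine ((i1.sub i2).abs).congr ?_
      filter_upwards [ae_restrict_of_ae (Measure.ae_ne (volume : Measure E) 0)] with z hz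
      have : 0 < ‖z‖ := norm_pos_iff.2 hz
      simp only [Pi.sub_apply, kernelDefect]
      rw [← abs_of_nonneg (by positivity : 0 ≤ ‖z‖ ^ β), ← abs_mul, Real.rpow_add this,
        abs_of_nonneg (by positivity : 0 ≤ ‖z‖ ^ β)]
      ring_nf
    · have : 0 < ‖z‖ := by linarith
      rw [abs_of_nonneg (by positivity), Real.rpow_add this, ← mul_assoc]
      gcongr
      exact hM z hz
  rw [← integrable_comp_smul_iff (volume : Measure E) _ hh.ne']
  refine (h1.const_mul (h ^ (p - 2 + β))).congr (Eventually.of_forall fun z => ?_)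
  simp only
  rw [kernelDefect_smul a e p hh, abs_mul, abs_of_pos (Real.rpow_pos_of_pos hh _),
    norm_smul, Real.norm_of_nonneg hh.le, Real.mul_rpow hh.le (norm_nonneg _), Real.rpow_add hh]
  ring

end Stencil

/-! ### The fractional Laplacian and the truncation error at a point -/

section Translation

variable {E : Type*} [NormedAddCommGroup E] [MeasureSpace E] [MeasurableAdd E]
  [(volume : Measure E).IsAddLeftInvariant]

theorem ae_comp_add_left {P : E → Prop} (h : ∀ᵐ y, P y) (x : E) : ∀ᵐ z, P (x + z) :=
  (measurePreserving_add_left (volume : Measure E) x).quasiMeasurePreserving.ae h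

theorem aestronglyMeasurable_comp_add_left {f : E → ℝ} (hf : AEStronglyMeasurable f) (x : E) :
    AEStronglyMeasurable fun z => f (x + z) :=
  hf.comp_measurePreserving (measurePreserving_add_left (volume : Measure E) x)

end Translation

theorem measurableSet_lt_norm {E : Type*} [NormedAddCommGroup E] [MeasurableSpace E] [BorelSpace E]
    (ε : ℝ) : MeasurableSet {z : E | ε < ‖z‖} :=
  measurableSet_lt measurable_const measurable_norm

theorem lapIntegrand_eq_mul_rpow {E : Type*} [NormedAddCommGroup E] [InnerProductSpace ℝ E]
    (s : ℝ) (u : E → ℝ) (x y : E) : lapIntegrand s u x y =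
      ‖x - y‖ ^ (-((Module.finrank ℝ E : ℝ) + 2 * s)) * (u x - u y) := by
  rw [lapIntegrand, Real.rpow_neg (norm_nonneg _)]
  ring

section Truncation

variable {E : Type*} [NormedAddCommGroup E] [InnerProductSpace ℝ E] [FiniteDimensional ℝ E]
  [MeasureSpace E] [BorelSpace E] [(volume : Measure E).IsAddHaarMeasure]

local notation "dim" => (Module.finrank ℝ E : ℝ)

theorem ae_comp_sub_left {P : E → Prop} (h : ∀ᵐ y, P y) (x : E) : ∀ᵐ z, P (x - z) :=
  (Measure.measurePreserving_sub_left (volume : Measure E) x).quasiMeasurePreserving.ae h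

theorem aestronglyMeasurable_comp_sub_left {f : E → ℝ} (hf : AEStronglyMeasurable f) (x : E) :
    AEStronglyMeasurable fun z => f (x - z) :=
  hf.comp_measurePreserving (Measure.measurePreserving_sub_left (volume : Measure E) x)

theorem integrableOn_rpow_mul_of_bounded {q ε M : ℝ} (hq : q < -dim) (hε : 0 < ε) {f : E → ℝ}
    (hf : AEStronglyMeasurable f) (hM : ∀ᵐ z, |f z| ≤ M) :
    IntegrableOn (fun z : E => ‖z‖ ^ q * f z) {z : E | ε < ‖z‖} := by
  refine Integrable.mul_bdd ?_ hf.restrict (ae_restrict_of_ae hM)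
  refine (integrableOn_norm_rpow_compl_ball hq hε).mono_set fun z hz => ?_
  simpa using (le_of_lt hz : ε ≤ ‖z‖)

theorem integrableOn_lapIntegrand {s ε M : ℝ} (hs : 0 < s) (hε : 0 < ε) {u : E → ℝ} (x : E)
    (hu : AEStronglyMeasurable u) (hM : ∀ᵐ y, |u y| ≤ M) :
    IntegrableOn (lapIntegrand s u x) {y : E | ε < ‖x - y‖} := by
  have h1 : IntegrableOn (fun z : E => ‖z‖ ^ (-(dim + 2 * s)) * (u x - u (x - z)))
      {z : E | ε < ‖z‖} := by
    refine integrableOn_rpow_mul_of_bounded (M := |u x| + M) (by linarith) hε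
      (aestronglyMeasurable_const.sub (aestronglyMeasurable_comp_sub_left hu x)) ?_
    filter_upwards [ae_comp_sub_left hM x] with z hz
    exact (abs_sub _ _).trans (by linarith)
  have h2 := ((integrable_indicator_iff (measurableSet_lt_norm ε)).2 h1).comp_sub_left x
  have hm : MeasurableSet {y : E | ε < ‖x - y‖} :=
    measurableSet_lt measurable_const (by fun_prop)
  rw [← integrable_indicator_iff hm]
  refine h2.congr (Eventually.of_forall fun y => ?_)
  simp only [Set.indicator_apply, Set.mem_ofPred_eq, sub_sub_cancel, lapIntegrand_eq_mul_rpow]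

/-- Averaging over `z ↦ -z` writes the truncated integral with symmetric differences. -/
theorem setIntegral_lapIntegrand {s ε M : ℝ} (hs : 0 < s) (hε : 0 < ε) {u : E → ℝ} (x : E)
    (hu : AEStronglyMeasurable u) (hM : ∀ᵐ y, |u y| ≤ M) :
    ∫ y in {y : E | ε < ‖x - y‖}, lapIntegrand s u x y =
      -(1 / 2) * ∫ z in {z : E | ε < ‖z‖},
        ‖z‖ ^ (-(dim + 2 * s)) * (u (x + z) + u (x - z) - 2 * u x) := by
  have hm : MeasurableSet {y : E | ε < ‖x - y‖} :=
    measurableSet_lt measurable_const (by fun_prop)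
  have hq : -(dim + 2 * s) < -dim := by linarith
  have h1 : ∫ y in {y : E | ε < ‖x - y‖}, lapIntegrand s u x y =
      ∫ z in {z : E | ε < ‖z‖}, ‖z‖ ^ (-(dim + 2 * s)) * (u x - u (x - z)) := by
    rw [← integral_indicator hm, ← integral_indicator (measurableSet_lt_norm ε),
      ← integral_sub_left_eq_self _ _ x]
    refine integral_congr_ae (Eventually.of_forall fun y => ?_)
    simp only [Set.indicator_apply, Set.mem_ofPred_eq, sub_sub_cancel, lapIntegrand_eq_mul_rpow]
  have h2 : ∫ z in {z : E | ε < ‖z‖}, ‖z‖ ^ (-(dim + 2 * s)) * (u x - u (x - z)) =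
      ∫ z in {z : E | ε < ‖z‖}, ‖z‖ ^ (-(dim + 2 * s)) * (u x - u (x + z)) := by
    rw [← integral_indicator (measurableSet_lt_norm ε),
      ← integral_indicator (measurableSet_lt_norm ε), ← integral_neg_eq_self]
    refine integral_congr_ae (Eventually.of_forall fun y => ?_)
    simp only [Set.indicator_apply, Set.mem_ofPred_eq, norm_neg, sub_neg_eq_add]
  have i1 : IntegrableOn (fun z : E => ‖z‖ ^ (-(dim + 2 * s)) * (u x - u (x - z)))
      {z : E | ε < ‖z‖} := by
    refine integrableOn_rpow_mul_of_bounded (M := |u x| + M) hq hε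
      (aestronglyMeasurable_const.sub (aestronglyMeasurable_comp_sub_left hu x)) ?_
    filter_upwards [ae_comp_sub_left hM x] with z hz
    exact (abs_sub _ _).trans (by linarith)
  have i2 : IntegrableOn (fun z : E => ‖z‖ ^ (-(dim + 2 * s)) * (u x - u (x + z)))
      {z : E | ε < ‖z‖} := by
    refine integrableOn_rpow_mul_of_bounded (M := |u x| + M) hq hε
      (aestronglyMeasurable_const.sub (aestronglyMeasurable_comp_add_left hu x)) ?_
    filter_upwards [ae_comp_add_left hM x] with z hz
    exact (abs_sub _ _).trans (by linarith)
  have h3 := integral_add i1 i2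
  have h4 : ∫ z in {z : E | ε < ‖z‖},
      ‖z‖ ^ (-(dim + 2 * s)) * (u (x + z) + u (x - z) - 2 * u x) =
      -∫ z in {z : E | ε < ‖z‖}, (‖z‖ ^ (-(dim + 2 * s)) * (u x - u (x - z)) +
        ‖z‖ ^ (-(dim + 2 * s)) * (u x - u (x + z))) := by
    rw [← integral_neg]
    congr 1; ext z; ring
  rw [h4, h3, h1, ← h2]
  ring

theorem tendsto_setIntegral_lt_norm {f : E → ℝ} [Nontrivial E] (hf : Integrable f) :
    Tendsto (fun ε : ℝ => ∫ z in {z : E | ε < ‖z‖}, f z) (𝓝[>] 0) (𝓝 (∫ z, f z)) := by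
  simp only [← integral_indicator (measurableSet_lt_norm (E := E) _)]
  refine tendsto_integral_filter_of_dominated_convergence (fun z => ‖f z‖)
    (Eventually.of_forall fun ε => hf.aestronglyMeasurable.indicator (measurableSet_lt_norm ε))
    (Eventually.of_forall fun ε => Eventually.of_forall fun z => norm_indicator_le_norm_self _ _)
    hf.norm ?_
  filter_upwards [Measure.ae_ne (volume : Measure E) 0] with z hz
  refine tendsto_const_nhds.congr' ?_
  have : ∀ᶠ ε in 𝓝[>] (0 : ℝ), ε < ‖z‖ :=
    nhdsWithin_le_nhds (eventually_lt_nhds (norm_pos_iff.2 hz))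
  filter_upwards [this] with ε hε
  rw [Set.indicator_of_mem (by exact hε)]

variable [Nontrivial E]

theorem integrable_rpow_mul_of_le {q β A M : ℝ} (hq : q < -dim) (hβ : -dim < q + β) {f : E → ℝ}
    (hf : AEStronglyMeasurable f) (hM : ∀ᵐ z, |f z| ≤ M) (hA : ∀ᵐ z, |f z| ≤ A * ‖z‖ ^ β) :
    Integrable fun z : E => ‖z‖ ^ q * f z := by
  rw [← integrableOn_univ, ← Set.union_compl_self (Metric.ball (0 : E) 1)]
  have hm : AEStronglyMeasurable fun z : E => ‖z‖ ^ q * f z :=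
    (measurable_norm.pow_const q).aestronglyMeasurable.mul hf
  refine IntegrableOn.union ?_ ?_
  · refine Integrable.mono' ((integrableOn_norm_rpow_ball (E := E) hβ 1).const_mul A)
      hm.restrict (ae_restrict_of_ae ?_)
    filter_upwards [hA, Measure.ae_ne (volume : Measure E) 0] with z hz hz0
    rw [Real.norm_eq_abs, abs_mul, abs_of_nonneg (by positivity),
      Real.rpow_add (norm_pos_iff.2 hz0), mul_left_comm]
    gcongr
  · exact (integrableOn_norm_rpow_compl_ball hq one_pos).mul_bdd hf.restrict
      (ae_restrict_of_ae hM)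

/-- Symmetric differences of order `β > 2 s` make the symmetrised integral absolutely convergent,
and the principal value is its value. -/
theorem hasFracLap_of_symmetric_bound {s β A M : ℝ} (hs : 0 < s) (hβ : 2 * s < β) {u : E → ℝ}
    {x : E} (hu : AEStronglyMeasurable u) (hM : ∀ᵐ y, |u y| ≤ M)
    (hA : ∀ᵐ z, |u (x + z) + u (x - z) - 2 * u x| ≤ A * ‖z‖ ^ β) :
    Integrable (fun z => ‖z‖ ^ (-(dim + 2 * s)) * (u (x + z) + u (x - z) - 2 * u x)) ∧
    HasFracLap s u x (-(lapConst (Module.finrank ℝ E) s / 2) *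
      ∫ z, ‖z‖ ^ (-(dim + 2 * s)) * (u (x + z) + u (x - z) - 2 * u x)) := by
  have hi : Integrable (fun z => ‖z‖ ^ (-(dim + 2 * s)) * (u (x + z) + u (x - z) - 2 * u x)) := by
    refine integrable_rpow_mul_of_le (M := 2 * M + 2 * |u x|) (by linarith) (by linarith)
      (((aestronglyMeasurable_comp_add_left hu x).add
        (aestronglyMeasurable_comp_sub_left hu x)).sub aestronglyMeasurable_const) ?_ hA
    filter_upwards [ae_comp_add_left hM x, ae_comp_sub_left hM x] with z h1 h2
    refine (abs_sub _ _).trans ?_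
    have := abs_add_le (u (x + z)) (u (x - z))
    rw [abs_mul, abs_two]
    linarith
  refine ⟨hi, fun ε hε => integrableOn_lapIntegrand hs hε x hu hM, ?_⟩
  have h := (tendsto_setIntegral_lt_norm hi).const_mul (-(lapConst (Module.finrank ℝ E) s / 2))
  refine h.congr' ?_
  filter_upwards [self_mem_nhdsWithin] with ε hε
  rw [truncLap, setIntegral_lapIntegrand hs hε x hu hM]
  ring

variable {J : Type*} [Fintype J]

/-- The discrete Laplacian of a Riesz potential is convolution with that of the kernel. -/
theorem discLap_riesz (a : J → ℝ) (e : J → E) {s h M R : ℝ} (hs : s < 1) {v : E → ℝ}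
    (hv : AEStronglyMeasurable v) (hM : ∀ᵐ y, |v y| ≤ M) (hR : ∀ y, R ≤ ‖y‖ → v y = 0) (x : E) :
    discLap a e h (riesz (s - 1) v) x = rieszConst (Module.finrank ℝ E) (s - 1) *
      ∫ z, discLap a e h (fun z : E => ‖z‖ ^ (-2 * (s - 1) - dim)) z * v (x - z) := by
  set p := -2 * (s - 1) - dim with hp
  have hpd : -dim < p := by rw [hp]; linarith
  -- The potentials at all stencil points are written with the same argument `x - z` of `v`, so
  -- that the differences fall on the kernel.
  have h1 (w : E) : riesz (s - 1) v (x + w) =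
      rieszConst (Module.finrank ℝ E) (s - 1) * ∫ z, ‖z + w‖ ^ p * v (x - z) := by
    rw [riesz, ← integral_sub_left_eq_self _ _ x]
    congr 2; ext z
    rw [show x + w - (x - z) = z + w by abel]
  have hi (w : E) : Integrable fun z => ‖z + w‖ ^ p * v (x - z) := by
    refine integrable_norm_add_rpow_mul hpd w (aestronglyMeasurable_comp_sub_left hv x)
      (R := R + ‖x‖) (ae_comp_sub_left hM x) fun z hz => hR _ ?_
    have := norm_sub_norm_le z x
    rw [norm_sub_rev] at this
    linarith
  have h2 (w : E) : secondDiff (riesz (s - 1) v) w x = rieszConst (Module.finrank ℝ E) (s - 1) *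
      ∫ z, secondDiff (fun z : E => ‖z‖ ^ p) w z * v (x - z) := by
    have h0 := h1 0
    simp only [add_zero] at h0
    have hi0 := hi 0
    simp only [add_zero] at hi0
    have e1 (z : E) : secondDiff (fun z : E => ‖z‖ ^ p) w z * v (x - z) =
        (‖z + w‖ ^ p * v (x - z) + ‖z + -w‖ ^ p * v (x - z)) - 2 * (‖z‖ ^ p * v (x - z)) := by
      simp only [secondDiff, sub_eq_add_neg]; ring
    have i12 : Integrable fun z => ‖z + w‖ ^ p * v (x - z) + ‖z + -w‖ ^ p * v (x - z) :=
      (hi w).add (hi (-w))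
    simp only [e1]
    rw [integral_sub i12 (hi0.const_mul 2), integral_add (hi w) (hi (-w)), integral_const_mul,
      secondDiff, h1, sub_eq_add_neg x w, h1, h0]
    ring
  have i2 (w : E) : Integrable fun z => secondDiff (fun z : E => ‖z‖ ^ p) w z * v (x - z) := by
    have hi0 := hi 0
    simp only [add_zero] at hi0
    refine (((hi w).add (hi (-w))).sub (hi0.const_mul 2)).congr (Eventually.of_forall fun z => ?_)
    simp only [secondDiff, Pi.sub_apply, Pi.add_apply, sub_eq_add_neg]; ring
  have e3 (z : E) : discLap a e h (fun z : E => ‖z‖ ^ p) z * v (x - z) =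
      (∑ j, a j * (secondDiff (fun z : E => ‖z‖ ^ p) (h • e j) z * v (x - z))) / h ^ 2 := by
    rw [discLap, div_mul_eq_mul_div, Finset.sum_mul]
    simp only [mul_assoc]
  simp only [e3]
  rw [integral_div, integral_finsetSum _ fun j _ => (i2 _).const_mul _, discLap]
  simp only [h2, integral_const_mul]
  rw [← mul_div_assoc, Finset.mul_sum]
  congr 1
  exact Finset.sum_congr rfl fun j _ => by ring

/-- As the discrete Laplacian of the kernel is even with integral zero, its convolution with `v`
only sees the symmetric differences of `v` about an arbitrary constant `c`. -/
theorem integral_discLap_mul_comp_sub (a : J → ℝ) (e : J → E) {p h M : ℝ} (hp : -dim < p)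
    (hp2 : p - 2 < -dim) {v : E → ℝ} (hv : AEStronglyMeasurable v) (hM : ∀ᵐ y, |v y| ≤ M)
    (x : E) (c : ℝ) :
    Integrable (fun z => discLap a e h (fun z : E => ‖z‖ ^ p) z *
      (v (x + z) + v (x - z) - 2 * c)) ∧
    ∫ z, discLap a e h (fun z : E => ‖z‖ ^ p) z * v (x - z) =
      1 / 2 * ∫ z, discLap a e h (fun z : E => ‖z‖ ^ p) z *
        (v (x + z) + v (x - z) - 2 * c) := by
  set S := discLap a e h (fun z : E => ‖z‖ ^ p) with hS
  have hi : Integrable S := integrable_discLap_norm_rpow a e hp hp2 h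
  have i1 : Integrable fun z => S z * v (x + z) :=
    hi.mul_bdd (aestronglyMeasurable_comp_add_left hv x) (ae_comp_add_left hM x)
  have i2 : Integrable fun z => S z * v (x - z) :=
    hi.mul_bdd (aestronglyMeasurable_comp_sub_left hv x) (ae_comp_sub_left hM x)
  have h1 : ∫ z, S z * v (x + z) = ∫ z, S z * v (x - z) := by
    rw [← integral_neg_eq_self]
    congr 1; ext z
    rw [hS, discLap_norm_rpow_neg, sub_eq_add_neg]
  have i12 : Integrable fun z => S z * v (x + z) + S z * v (x - z) := i1.add i2
  have e1 (z : E) : S z * (v (x + z) + v (x - z) - 2 * c) =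
      S z * v (x + z) + S z * v (x - z) - S z * (2 * c) := by ring
  simp only [e1]
  refine ⟨i12.sub (hi.mul_const _), ?_⟩
  rw [integral_sub i12 (hi.mul_const _), integral_add i1 i2, integral_mul_const, h1,
    hS, integral_discLap_norm_rpow a e hp hp2 h]
  ring

/-- Truncation error at a point `x`, where `u` has symmetric differences of order `β` and `v` is
within `B h ^ β` of `u`. The constant depends only on the space, the stencil, `s` and `β`. -/
theorem exists_truncation_error_bound {a : J → ℝ} {e : J → E} (hc : IsConsistent a e) {s β : ℝ}
    (hs : 0 < s) (hs1 : s < 1) (hn : dim / 2 + (s - 1) ≠ 0) (hβ : 2 * s < β) (hβ2 : β ≤ 2) :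
    ∃ C : ℝ, 0 ≤ C ∧ ∀ (h A B M M' R : ℝ) (u v : E → ℝ) (x : E), 0 < h → 0 ≤ A → 0 ≤ B →
      AEStronglyMeasurable u → AEStronglyMeasurable v → (∀ᵐ y, |u y| ≤ M) →
      (∀ᵐ y, |v y| ≤ M') → (∀ y, R ≤ ‖y‖ → v y = 0) →
      (∀ᵐ z, |u (x + z) + u (x - z) - 2 * u x| ≤ A * ‖z‖ ^ β) →
      (∀ᵐ y, |v y - u y| ≤ B * h ^ β) →
      HasFracLap s u x (fracLap s u x) ∧
        |fracLap s u x - -discLap a e h (riesz (s - 1) v) x| ≤ C * (A + B) * h ^ (β - 2 * s) := by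
  set p := -2 * (s - 1) - dim with hp
  have hpd : -dim < p := by rw [hp]; linarith
  have hpd2 : p - 2 < -dim := by rw [hp]; linarith
  have hp2 : -(dim + 2 * s) = p - 2 := by rw [hp]; ring
  set cR := rieszConst (Module.finrank ℝ E) (s - 1) with hcR
  have hcL : lapConst (Module.finrank ℝ E) s = cR * (p * (p + dim - 2)) := by
    rw [lapConst_eq_rieszConst hs1 hn, hp]; ring
  set I1 := ∫ z, |discLap a e 1 (fun z : E => ‖z‖ ^ p) z| with hI1
  set I2 := ∫ z, |kernelDefect a e p 1 z| * ‖z‖ ^ β with hI2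
  have hI1' : 0 ≤ I1 := integral_nonneg fun z => abs_nonneg _
  have hI2' : 0 ≤ I2 := integral_nonneg fun z => by positivity
  refine ⟨|cR| / 2 * (2 * I1 + I2), by positivity, ?_⟩
  intro h A B M M' R u v x hh hA0 hB0 hu hv hM hM' hR hA hB
  obtain ⟨iW, hW⟩ := hasFracLap_of_symmetric_bound hs hβ hu hM hA
  have hl : fracLap s u x = _ := hW.2.limUnder_eq
  rw [hl]
  refine ⟨hW, ?_⟩
  obtain ⟨iV, hV⟩ := integral_discLap_mul_comp_sub a e (h := h) hpd hpd2 hv hM' x (u x)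
  rw [discLap_riesz a e hs1 hv hM' hR x, ← hp, hV, hcL, ← hcR]
  rw [hp2] at iW ⊢
  set S := discLap a e h (fun z : E => ‖z‖ ^ p) with hS
  set W := fun z => u (x + z) + u (x - z) - 2 * u x with hWdef
  set V := fun z => v (x + z) + v (x - z) - 2 * u x with hVdef
  set lam := p * (p + dim - 2) with hlam
  have key : -(cR * lam / 2) * (∫ z, ‖z‖ ^ (p - 2) * W z) - -(cR * (1 / 2 * ∫ z, S z * V z)) =
      cR / 2 * ∫ z, (S z * V z - lam * (‖z‖ ^ (p - 2) * W z)) := by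
    rw [integral_sub iV (iW.const_mul lam), integral_const_mul]
    ring
  refine (congrArg abs key).trans_le ?_
  have iS : Integrable S := integrable_discLap_norm_rpow a e hpd hpd2 h
  have iT := integrable_kernelDefect_mul hc hpd hpd2 (by linarith) (β := β)
    (by rw [hp]; linarith) (by rw [hp]; linarith) hh
  have bound : |∫ z, (S z * V z - lam * (‖z‖ ^ (p - 2) * W z))| ≤
      ∫ z, (|S z| * (2 * (B * h ^ β)) + |kernelDefect a e p h z| * ‖z‖ ^ β * A) := by
    rw [← Real.norm_eq_abs]
    refine norm_integral_le_of_norm_le ((iS.abs.mul_const _).add (iT.mul_const _)) ?_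
    filter_upwards [hA, ae_comp_add_left hB x, ae_comp_sub_left hB x] with z h1 h2 h3
    -- Replacing `v` by `u` costs the interpolation error; the rest is the kernel defect.
    have e1 : S z * V z - lam * (‖z‖ ^ (p - 2) * W z) =
        S z * ((v (x + z) - u (x + z)) + (v (x - z) - u (x - z))) +
          kernelDefect a e p h z * W z := by
      simp only [kernelDefect, ← hS, ← hlam, hVdef, hWdef]; ring
    rw [Real.norm_eq_abs, e1]
    refine (abs_add_le _ _).trans (add_le_add ?_ ?_)
    · rw [abs_mul]
      gcongr
      exact (abs_add_le _ _).trans (by linarith)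
    · rw [abs_mul, mul_assoc]
      gcongr
      rw [mul_comm]
      exact h1
  rw [integral_add (iS.abs.mul_const _) (iT.mul_const _), integral_mul_const, integral_mul_const,
    hS, integral_abs_discLap_norm_rpow a e p hh, integral_abs_kernelDefect_mul a e p β hh,
    ← hI1, ← hI2] at bound
  have q1 : h ^ (p - 2 + dim) * h ^ β = h ^ (β - 2 * s) := by
    rw [← Real.rpow_add hh, hp]; congr 1; ring
  have q2 : h ^ (p - 2 + β + dim) = h ^ (β - 2 * s) := by rw [hp]; congr 1; ring
  rw [q2] at bound
  set H := h ^ (β - 2 * s) with hH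
  have hH0 : 0 ≤ H := by positivity
  rw [abs_mul, abs_div, abs_two]
  calc |cR| / 2 * |∫ z, (S z * V z - lam * (‖z‖ ^ (p - 2) * W z))|
      ≤ |cR| / 2 * (2 * I1 * B * H + I2 * A * H) := by
        gcongr
        refine bound.trans (le_of_eq ?_)
        rw [← q1]; ring
    _ ≤ |cR| / 2 * (2 * I1 * (A + B) * H + I2 * (A + B) * H) := by
        gcongr <;> linarith
    _ = _ := by ring

end Truncation

/-! ### Hölder functions: Taylor bounds and interpolation errors -/

section Holder

variable {E : Type*} [NormedAddCommGroup E] [InnerProductSpace ℝ E] {α : ℝ} {U : Set E} {u : E → ℝ}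

theorem IsC1Holder.abs_le (hu : IsC1Holder α U u) {x : E} (hx : x ∈ U) :
    |u x| ≤ (c1HolderNorm α U u).toReal := by
  have h : ‖u x‖ₑ ≤ c1HolderNorm α U u :=
    (le_iSup₂ (f := fun x (_ : x ∈ U) => ‖u x‖ₑ) x hx).trans (le_self_add.trans le_self_add)
  simpa using ENNReal.toReal_mono hu.2.ne h

theorem IsC1Holder.norm_fderiv_sub_le (hα : 0 ≤ α) (hu : IsC1Holder α U u) {x y : E} (hx : x ∈ U)
    (hy : y ∈ U) :
    ‖fderiv ℝ u x - fderiv ℝ u y‖ ≤ (c1HolderNorm α U u).toReal * ‖x - y‖ ^ α := by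
  have hle : eHolderNorm α.toNNReal (U.domRestrict (fderiv ℝ u)) ≤ c1HolderNorm α U u :=
    le_add_self
  have hm : MemHolder α.toNNReal (U.domRestrict (fderiv ℝ u)) :=
    eHolderNorm_lt_top.1 (hle.trans_lt hu.2)
  have h := hm.holderWith.dist_le ⟨x, hx⟩ ⟨y, hy⟩
  rw [Real.coe_toNNReal α hα] at h
  have h2 : (nnHolderNorm α.toNNReal (U.domRestrict (fderiv ℝ u)) : ℝ) ≤
      (c1HolderNorm α U u).toReal := ENNReal.toReal_mono hu.2.ne hle
  rw [dist_eq_norm, Subtype.dist_eq, dist_eq_norm] at h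
  exact h.trans (by gcongr)

theorem IsC1Holder.abs_taylor_le (hα : 0 ≤ α) (hU : IsOpen U) (hc : Convex ℝ U)
    (hu : IsC1Holder α U u) {x y : E} (hx : x ∈ U) (hy : y ∈ U) :
    |u y - u x - fderiv ℝ u x (y - x)| ≤ (c1HolderNorm α U u).toReal * ‖y - x‖ ^ (1 + α) := by
  have hseg : segment ℝ x y ⊆ U := hc.segment_subset hx hy
  have h := (convex_segment x y).norm_image_sub_le_of_norm_hasFDerivWithin_le'
    (f := u) (f' := fderiv ℝ u) (φ := fderiv ℝ u x)
    (C := (c1HolderNorm α U u).toReal * ‖y - x‖ ^ α) (fun z hz => ?_) (fun z hz => ?_)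
    (left_mem_segment ℝ x y) (right_mem_segment ℝ x y)
  · refine h.trans (le_of_eq ?_)
    rw [mul_assoc, add_comm 1 α]
    rcases eq_or_ne (y - x) 0 with h0 | h0
    · simp [h0, Real.zero_rpow (by linarith : α + 1 ≠ 0)]
    · rw [Real.rpow_add_one (norm_ne_zero_iff.2 h0)]
  · exact ((hu.1.differentiableOn one_ne_zero).differentiableAt
      (hU.mem_nhds (hseg hz))).hasFDerivAt.hasFDerivWithinAt
  · refine (hu.norm_fderiv_sub_le hα (hseg hz) hx).trans ?_
    gcongr
    have := norm_sub_le_of_mem_segment hz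
    rwa [norm_sub_rev y x, norm_sub_rev z x] at *

theorem IsC1Holder.abs_symm_le (hα : 0 ≤ α) (hU : IsOpen U) (hc : Convex ℝ U)
    (hu : IsC1Holder α U u) {x z : E} (hx : x ∈ U) (h1 : x + z ∈ U) (h2 : x - z ∈ U) :
    |u (x + z) + u (x - z) - 2 * u x| ≤ 2 * (c1HolderNorm α U u).toReal * ‖z‖ ^ (1 + α) := by
  -- The first-order terms at `x + z` and `x - z` cancel.
  have e1 := hu.abs_taylor_le hα hU hc hx h1
  have e2 := hu.abs_taylor_le hα hU hc hx h2
  rw [add_sub_cancel_left] at e1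
  rw [sub_sub_cancel_left, norm_neg, map_neg] at e2
  calc _ = |(u (x + z) - u x - fderiv ℝ u x z) + (u (x - z) - u x - -fderiv ℝ u x z)| := by
        congr 1; ring
    _ ≤ _ := (abs_add_le _ _).trans (by linarith)

/-- An averaging operator that reproduces affine functions (`hw1`, `hwx`) and uses nodes at distance
at most `ρ` has error of order `ρ ^ (1 + α)`. -/
theorem IsC1Holder.abs_interpolation_le (hα : 0 ≤ α) (hU : IsOpen U) (hc : Convex ℝ U)
    (hu : IsC1Holder α U u) {ι : Type*} {I : Finset ι} {w : ι → ℝ} {x : ι → E} {y : E} {ρ : ℝ}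
    (hy : y ∈ U) (hx : ∀ i ∈ I, x i ∈ U) (hw : ∀ i ∈ I, 0 ≤ w i) (hw1 : ∑ i ∈ I, w i = 1)
    (hwx : ∑ i ∈ I, w i • (x i - y) = 0) (hρ : ∀ i ∈ I, w i ≠ 0 → ‖x i - y‖ ≤ ρ) :
    |∑ i ∈ I, u (x i) * w i - u y| ≤ (c1HolderNorm α U u).toReal * ρ ^ (1 + α) := by
  have h1 : ∑ i ∈ I, u (x i) * w i - u y =
      ∑ i ∈ I, w i * (u (x i) - u y - fderiv ℝ u y (x i - y)) := by
    -- The first-order terms cancel because `y` is the weighted mean of the nodes.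
    have e : ∑ i ∈ I, w i * fderiv ℝ u y (x i - y) = 0 := by
      rw [← map_zero (fderiv ℝ u y), ← hwx, map_sum]
      simp
    simp only [mul_sub (_ : ℝ) _ (fderiv ℝ u y _), Finset.sum_sub_distrib, e, sub_zero,
      mul_sub, ← Finset.sum_mul, hw1, one_mul]
    simp only [mul_comm]
  rw [h1]
  calc _ ≤ ∑ i ∈ I, w i * ((c1HolderNorm α U u).toReal * ρ ^ (1 + α)) := by
        refine (Finset.abs_sum_le_sum_abs _ _).trans (Finset.sum_le_sum fun i hi => ?_)
        rw [abs_mul, abs_of_nonneg (hw i hi)]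
        by_cases h0 : w i = 0
        · simp [h0]
        · refine mul_le_mul_of_nonneg_left ((hu.abs_taylor_le hα hU hc hy (hx i hi)).trans ?_)
            (hw i hi)
          have := hρ i hi h0
          gcongr
    _ = _ := by rw [← Finset.sum_mul, hw1, one_mul]

theorem dataNorm_nonneg {E : Type*} [NormedAddCommGroup E] [InnerProductSpace ℝ E]
    [MeasureSpace E] (α : ℝ) (U : Set E) (u : E → ℝ) : 0 ≤ dataNorm α U u :=
  add_nonneg ENNReal.toReal_nonneg ENNReal.toReal_nonneg

theorem ae_abs_le_eLpNorm {E : Type*} [MeasureSpace E] {u : E → ℝ}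
    (hu : MemLp u ⊤ (volume : Measure E)) : ∀ᵐ y, |u y| ≤ (eLpNorm u ⊤ volume).toReal := by
  have h := ae_le_eLpNormEssSup (f := u) (μ := (volume : Measure E))
  rw [← eLpNorm_exponent_top] at h
  filter_upwards [h] with y hy
  simpa using ENNReal.toReal_mono hu.2.ne hy

variable [FiniteDimensional ℝ E] [MeasureSpace E] [BorelSpace E]
  [(volume : Measure E).IsAddHaarMeasure]

/-- For `‖z‖ < δ` this is the Taylor bound; for `δ ≤ ‖z‖` boundedness of `u` suffices, as
`1 ≤ (‖z‖ / δ) ^ (1 + α)`. The bound is thus valid almost everywhere in the whole space. -/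
theorem IsC1Holder.ae_abs_symm_le (hα : 0 ≤ α) (hU : IsOpen U) (hc : Convex ℝ U)
    (hu : IsC1Holder α U u) (hm : MemLp u ⊤ volume) {δ : ℝ} (hδ : 0 < δ) {x : E}
    (hx : ∀ z, ‖z‖ < δ → x + z ∈ U) :
    ∀ᵐ z, |u (x + z) + u (x - z) - 2 * u x| ≤
      (2 + 2 / δ ^ (1 + α)) * dataNorm α U u * ‖z‖ ^ (1 + α) := by
  have hb := ae_abs_le_eLpNorm hm
  have hxU : x ∈ U := by simpa using hx 0 (by simpa using hδ)
  filter_upwards [ae_comp_add_left hb x, ae_comp_sub_left hb x] with z h1 h2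
  have hK1 : 0 ≤ (c1HolderNorm α U u).toReal := ENNReal.toReal_nonneg
  have hK2 : 0 ≤ (eLpNorm u ⊤ volume).toReal := ENNReal.toReal_nonneg
  rw [dataNorm]
  set K1 := (c1HolderNorm α U u).toReal with hK1'
  set K2 := (eLpNorm u ⊤ volume).toReal
  rcases lt_or_ge ‖z‖ δ with hz | hz
  · have hxz : x - z ∈ U := by
      rw [sub_eq_add_neg]; exact hx _ (by rwa [norm_neg])
    refine (hu.abs_symm_le hα hU hc hxU (hx z hz) hxz).trans ?_
    rw [← hK1']
    have h3 : 0 ≤ 2 / δ ^ (1 + α) := by positivity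
    have h4 : 2 * K1 ≤ (2 + 2 / δ ^ (1 + α)) * (K1 + K2) := by gcongr <;> linarith
    gcongr
  · have h3 : |u (x + z) + u (x - z) - 2 * u x| ≤ 2 * (K1 + K2) := by
      refine (abs_sub _ _).trans ?_
      have e1 := abs_add_le (u (x + z)) (u (x - z))
      have e2 := hu.abs_le hxU
      rw [abs_mul, abs_two]
      linarith
    have h4 : 1 ≤ ‖z‖ ^ (1 + α) / δ ^ (1 + α) := by
      rw [one_le_div (by positivity)]
      gcongr
    calc _ ≤ 2 * (K1 + K2) * 1 := by rw [mul_one]; exact h3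
      _ ≤ 2 * (K1 + K2) * (‖z‖ ^ (1 + α) / δ ^ (1 + α)) := by gcongr
      _ = 2 / δ ^ (1 + α) * (K1 + K2) * ‖z‖ ^ (1 + α) := by ring
      _ ≤ _ := by gcongr; linarith

end Holder

/-! ### Grids, discrete norms and hat functions -/

section Grid

theorem gridSupNorm_le {ι : Type*} {I : Finset ι} {e : ι → ℝ} {T : ℝ} (hT : 0 ≤ T)
    (h : ∀ i ∈ I, |e i| ≤ T) : gridSupNorm I e ≤ T :=
  Real.iSup_le (fun i => h i i.2) hT

theorem gridL2Norm_le {ι : Type*} {I : Finset ι} {e : ι → ℝ} {T h : ℝ} {n N : ℕ} (hh : 0 ≤ h)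
    (hT : 0 ≤ T) (hI : I.card ≤ N ^ n) (he : ∀ i ∈ I, |e i| ≤ T) :
    gridL2Norm n h I e ≤ Real.sqrt ((h * N) ^ n) * T := by
  rw [gridL2Norm, ← Real.sqrt_sq hT, ← Real.sqrt_mul (by positivity)]
  refine Real.sqrt_le_sqrt ?_
  have h1 : ∑ i ∈ I, e i ^ 2 ≤ N ^ n * T ^ 2 := by
    calc ∑ i ∈ I, e i ^ 2 ≤ ∑ i ∈ I, T ^ 2 := by
          refine Finset.sum_le_sum fun i hi => ?_
          rw [← sq_abs]
          have := he i hi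
          gcongr
      _ = I.card * T ^ 2 := by simp
      _ ≤ _ := by gcongr; exact_mod_cast hI
  calc h ^ n * ∑ i ∈ I, e i ^ 2 ≤ h ^ n * (N ^ n * T ^ 2) := by gcongr
    _ = _ := by rw [mul_pow]; ring

theorem mesh_pos {L : ℝ} {N : ℕ} (hL : 0 < L) (hN : 0 < N) : 0 < mesh L N := by
  have : (0 : ℝ) < N := by exact_mod_cast hN
  unfold mesh
  positivity

theorem mesh_mul {L : ℝ} {N : ℕ} (hN : 0 < N) : mesh L N * N = 2 * L := by
  have : (N : ℝ) ≠ 0 := by exact_mod_cast hN.ne'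
  unfold mesh
  field_simp

theorem node_add_one (L : ℝ) (N : ℕ) (i : ℤ) : node L N (i + 1) = node L N i + mesh L N := by
  simp only [node]; push_cast; ring

theorem node_sub_one (L : ℝ) (N : ℕ) (i : ℤ) : node L N (i - 1) = node L N i - mesh L N := by
  simp only [node]; push_cast; ring

theorem node_mem_Icc {L : ℝ} {N : ℕ} (hL : 0 < L) (hN : 0 < N) {i : ℤ} (h0 : 0 ≤ i)
    (h1 : i ≤ N) : node L N i ∈ Set.Icc (-L) L := by
  have hm := mesh_pos hL hN
  have h2 := mesh_mul (L := L) hN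
  have h0' : (0 : ℝ) ≤ i := by exact_mod_cast h0
  have h1' : (i : ℝ) ≤ N := by exact_mod_cast h1
  have h3 := mul_nonneg h0' hm.le
  have h4 := mul_le_mul_of_nonneg_right h1' hm.le
  constructor <;> simp only [node] <;> linarith

theorem hat_nonneg {h : ℝ} (y : ℝ) : 0 ≤ hat h y := by
  unfold hat
  split_ifs with hy
  · have : 0 < h := (abs_nonneg y).trans_lt hy
    rw [sub_nonneg, div_le_one this]
    exact hy.le
  · exact le_rfl

theorem hat_eq_zero {h y : ℝ} (hy : h ≤ |y|) : hat h y = 0 := if_neg (not_lt.2 hy)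

theorem abs_lt_of_hat_ne_zero {h y : ℝ} (hy : hat h y ≠ 0) : |y| < h := by
  by_contra hc
  exact hy (hat_eq_zero (not_lt.1 hc))

theorem measurable_hat (h : ℝ) : Measurable (hat h) := by
  unfold hat
  exact Measurable.ite (measurableSet_lt (by fun_prop) measurable_const) (by fun_prop)
    measurable_const

/-- At a point of the cell `[x_k, x_{k+1}]` only the hats of the two end points contribute. For
`y = L` the cell is `[x_N, x_{N+1}]` with `f = 0`, so that the node outside the grid has weight
zero. -/
theorem exists_sum_hat_mul {L : ℝ} {N : ℕ} (hL : 0 < L) (hN : 0 < N) {y : ℝ}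
    (hy : y ∈ Set.Icc (-L) L) : ∃ (k : ℤ) (f : ℝ), y = node L N k + f * mesh L N ∧
      ∀ g : ℤ → ℝ, ∑ i ∈ Finset.Icc (0 : ℤ) N, hat (mesh L N) (y - node L N i) * g i =
        (1 - f) * g k + f * g (k + 1) := by
  have hm := mesh_pos hL hN
  have hmN := mesh_mul (L := L) hN
  set h := mesh L N with hh
  set t := (y + L) / h with ht
  have hyt : y = -L + t * h := by rw [ht]; field_simp; ring
  have ht0 : 0 ≤ t := div_nonneg (by linarith [hy.1]) hm.le
  have htN : t ≤ N := by rw [ht, div_le_iff₀ hm]; linarith [hy.2]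
  have hk1 := Int.floor_le t
  have hk2 := Int.lt_floor_add_one t
  have hk0 : 0 ≤ ⌊t⌋ := Int.floor_nonneg.2 ht0
  have hkN : ⌊t⌋ ≤ N := by exact_mod_cast hk1.trans htN
  set k := ⌊t⌋ with hk
  have hdiff (i : ℤ) : y - node L N i = (t - i) * h := by rw [hyt, node]; ring
  have habs (i : ℤ) : |y - node L N i| = |t - i| * h := by rw [hdiff, abs_mul, abs_of_pos hm]
  have hlt (i : ℤ) (hi : |t - i| < 1) : hat h (y - node L N i) = 1 - |t - i| := by
    rw [hat, habs, if_pos (by nlinarith), mul_div_cancel_right₀ _ hm.ne']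
  have hge (i : ℤ) (hi : 1 ≤ |t - i|) : hat h (y - node L N i) = 0 :=
    hat_eq_zero (by rw [habs]; nlinarith)
  have hTk : hat h (y - node L N k) = 1 - (t - k) := by
    have : |t - k| = t - k := abs_of_nonneg (by linarith)
    rw [hlt k (by rw [this]; linarith), this]
  have hTk1 : hat h (y - node L N (k + 1)) = t - k := by
    have : |t - (k + 1 : ℤ)| = 1 - (t - k) := by
      push_cast
      rw [abs_of_nonpos (by linarith)]; ring
    rcases hk1.eq_or_lt with h0 | h0
    · rw [hge _ (by rw [this]; linarith)]; linarith
    · rw [hlt _ (by rw [this]; linarith), this]; ring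
  refine ⟨k, t - k, by rw [hyt, node]; ring, fun g => ?_⟩
  -- If `k = N`, then `k + 1` is not a grid index, but `t = N` and its hat vanishes at `y`.
  have s1 : ∑ i ∈ Finset.Icc (0 : ℤ) N, hat h (y - node L N i) * g i =
      ∑ i ∈ insert (k + 1) (Finset.Icc (0 : ℤ) N), hat h (y - node L N i) * g i := by
    refine Finset.sum_subset (Finset.subset_insert _ _) fun i hi hi' => ?_
    have hik : i = k + 1 := (Finset.mem_insert.1 hi).resolve_right hi'
    have hkN' : (N : ℤ) ≤ k := by
      by_contra hc
      exact hi' (Finset.mem_Icc.2 ⟨by omega, by omega⟩)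
    have : (N : ℝ) ≤ k := by exact_mod_cast hkN'
    rw [hik, hTk1, show t - k = 0 by linarith, zero_mul]
  have s2 : ∑ i ∈ ({k, k + 1} : Finset ℤ), hat h (y - node L N i) * g i =
      ∑ i ∈ insert (k + 1) (Finset.Icc (0 : ℤ) N), hat h (y - node L N i) * g i := by
    refine Finset.sum_subset (fun i hi => ?_) fun i _ hi' => ?_
    · simp only [Finset.mem_insert, Finset.mem_singleton, Finset.mem_Icc] at hi ⊢
      omega
    · simp only [Finset.mem_insert, Finset.mem_singleton, not_or] at hi'
      rw [hge i ?_, zero_mul]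
      rcases lt_or_gt_of_ne hi'.1 with h3 | h3
      · have : (i : ℝ) + 1 ≤ k := by exact_mod_cast h3
        rw [abs_of_nonneg (by linarith)]; linarith
      · have : (k : ℝ) + 1 + 1 ≤ i := by
          have : k + 1 + 1 ≤ i := by omega
          exact_mod_cast this
        rw [abs_of_nonpos (by linarith)]; linarith
  rw [s1, ← s2, Finset.sum_pair (by omega), hTk, hTk1]

theorem sum_hat {L : ℝ} {N : ℕ} (hL : 0 < L) (hN : 0 < N) {y : ℝ} (hy : y ∈ Set.Icc (-L) L) :
    ∑ i ∈ Finset.Icc (0 : ℤ) N, hat (mesh L N) (y - node L N i) = 1 := by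
  obtain ⟨k, f, -, h⟩ := exists_sum_hat_mul hL hN hy
  simpa using h 1

theorem sum_hat_mul_node_sub {L : ℝ} {N : ℕ} (hL : 0 < L) (hN : 0 < N) {y : ℝ}
    (hy : y ∈ Set.Icc (-L) L) :
    ∑ i ∈ Finset.Icc (0 : ℤ) N, hat (mesh L N) (y - node L N i) * (node L N i - y) = 0 := by
  obtain ⟨k, f, hk, h⟩ := exists_sum_hat_mul hL hN hy
  rw [h, node_add_one, hk]
  ring

theorem hat_eq_zero_of_notMem_Icc {L y : ℝ} {N : ℕ} {i : ℤ}
    (hy : y ∉ Set.Icc (node L N (i - 1)) (node L N (i + 1))) :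
    hat (mesh L N) (y - node L N i) = 0 := by
  refine hat_eq_zero (not_lt.1 fun h => hy ?_)
  rw [abs_lt] at h
  rw [node_add_one, node_sub_one]
  constructor <;> linarith

end Grid

/-! ### The scheme at a point -/

section General

variable {E : Type*} [NormedAddCommGroup E] [InnerProductSpace ℝ E] [FiniteDimensional ℝ E]
  [MeasureSpace E] [BorelSpace E] [(volume : Measure E).IsAddHaarMeasure] [Nontrivial E]
  {J : Type*} [Fintype J]

/-- Error of a scheme applied to a perturbation `v` of `u` that differs from `u` only on a bounded
set `D`, by at most the interpolation error. The factor `2 h` bounds the distance between a point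
and the vertices of its cell in dimensions one and two. -/
theorem exists_scheme_error_bound {a : J → ℝ} {e : J → E} (hc : IsConsistent a e) {s α δ : ℝ}
    (hs : 0 < s) (hs1 : s < 1) (hn : (Module.finrank ℝ E : ℝ) / 2 + (s - 1) ≠ 0)
    (hα0 : 0 < α) (hα : 2 * s - 1 < α) (hα1 : α ≤ 1) (hδ : 0 < δ) :
    ∃ C : ℝ, 0 ≤ C ∧ ∀ (h : ℝ) (D U : Set E) (u v : E → ℝ) (x : E), 0 < h →
      IsOpen U → Convex ℝ U → IsC1Holder α U u → MemLp u ⊤ volume → HasCompactSupport u →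
      (∀ z, ‖z‖ < δ → x + z ∈ U) → AEStronglyMeasurable v → Bornology.IsBounded D →
      (∀ y ∈ D, |v y - u y| ≤ (c1HolderNorm α U u).toReal * (2 * h) ^ (1 + α)) →
      (∀ y ∉ D, v y = u y) →
      HasFracLap s u x (fracLap s u x) ∧
        |fracLap s u x - -discLap a e h (riesz (s - 1) v) x| ≤
          C * dataNorm α U u * h ^ (1 + α - 2 * s) := by
  obtain ⟨C, hC, hmain⟩ := exists_truncation_error_bound hc (β := 1 + α) hs hs1 hn
    (by linarith) (by linarith)
  refine ⟨C * ((2 + 2 / δ ^ (1 + α)) + 2 ^ (1 + α)), by positivity, ?_⟩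
  intro h D U u v x hh hU hcU hu hm hcs hx hv hD hvD hvu
  have hK1 : 0 ≤ (c1HolderNorm α U u).toReal := ENNReal.toReal_nonneg
  have hK : (c1HolderNorm α U u).toReal ≤ dataNorm α U u := le_add_of_nonneg_right
    ENNReal.toReal_nonneg
  have hK0 := hK1.trans hK
  have hb := ae_abs_le_eLpNorm hm
  have hvu' (y : E) : |v y - u y| ≤ 2 ^ (1 + α) * dataNorm α U u * h ^ (1 + α) := by
    by_cases hy : y ∈ D
    · refine (hvD y hy).trans ?_
      rw [Real.mul_rpow zero_le_two hh.le]
      calc _ ≤ dataNorm α U u * (2 ^ (1 + α) * h ^ (1 + α)) := by gcongr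
        _ = _ := by ring
    · rw [hvu y hy, sub_self, abs_zero]
      positivity
  obtain ⟨R, hR⟩ := (hcs.isCompact.isBounded.union hD).subset_ball 0
  have hsupp (y : E) (hy : R ≤ ‖y‖) : v y = 0 := by
    have hy' : y ∉ tsupport u ∪ D := fun hmem => by
      have := hR hmem
      rw [mem_ball_zero_iff] at this
      linarith
    rw [hvu y fun h => hy' (Or.inr h)]
    exact image_eq_zero_of_notMem_tsupport fun h => hy' (Or.inl h)
  have hvb : ∀ᵐ y, |v y| ≤
      (eLpNorm u ⊤ volume).toReal + 2 ^ (1 + α) * dataNorm α U u * h ^ (1 + α) := by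
    filter_upwards [hb] with y hy
    have := abs_sub_abs_le_abs_sub (v y) (u y)
    linarith [hvu' y]
  obtain ⟨h1, h2⟩ := hmain h ((2 + 2 / δ ^ (1 + α)) * dataNorm α U u)
    (2 ^ (1 + α) * dataNorm α U u) _ _ R u v x hh (by positivity) (by positivity) hm.1 hv hb hvb
    hsupp (hu.ae_abs_symm_le hα0.le hU hcU hm hδ hx) (Eventually.of_forall hvu')
  refine ⟨h1, h2.trans (le_of_eq ?_)⟩
  rw [← add_mul, ← mul_assoc]

end General

section Conclusion

variable {ι : Type*} {I : Finset ι} {err : ι → ℝ} {L : ℝ} {n N : ℕ}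

theorem grid_norms_le {T : ℝ} (hL : 0 < L) (hN : 0 < N) (hT : 0 ≤ T) (hI : I.card ≤ N ^ n)
    (he : ∀ i ∈ I, |err i| ≤ T) :
    gridSupNorm I err ≤ (1 + Real.sqrt ((2 * L) ^ n)) * T ∧
      gridL2Norm n (mesh L N) I err ≤ (1 + Real.sqrt ((2 * L) ^ n)) * T := by
  have h1 := gridSupNorm_le hT he
  have h2 := gridL2Norm_le (mesh_pos hL hN).le hT hI he
  rw [mesh_mul hN] at h2
  have h3 : 0 ≤ Real.sqrt ((2 * L) ^ n) * T := by positivity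
  constructor <;> linarith

end Conclusion

/-! ### One dimension -/

section OneDim

variable {L : ℝ} {N : ℕ}

theorem basis1_of_mem {x : ℝ} (hx : x ∈ dom1 L) (i : ℤ) :
    basis1 L N i x = hat (mesh L N) (x - node L N i) := by
  by_cases h : x ∈ Set.Icc (node L N (i - 1)) (node L N (i + 1))
  · unfold basis1
    refine Set.indicator_of_mem ?_ _
    exact ⟨h, hx⟩
  · rw [basis1, Set.indicator_of_notMem fun h' => h h'.1, hat_eq_zero_of_notMem_Icc h]

theorem interp1_of_mem {x : ℝ} (hx : x ∈ dom1 L) (u : ℝ → ℝ) :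
    interp1 L N u x =
      ∑ i ∈ Finset.Icc (0 : ℤ) N, u (node L N i) * hat (mesh L N) (x - node L N i) := by
  simp only [interp1, basis1_of_mem hx]
  rw [Set.indicator_of_notMem (by simpa using hx), add_zero]

theorem interp1_of_notMem {x : ℝ} (hx : x ∉ dom1 L) (u : ℝ → ℝ) : interp1 L N u x = u x := by
  have h (i : ℤ) : basis1 L N i x = 0 := Set.indicator_of_notMem (fun h => hx h.2) _
  simp only [interp1, h, mul_zero, Finset.sum_const_zero, zero_add]
  exact Set.indicator_of_mem hx u

theorem aestronglyMeasurable_interp1 {u : ℝ → ℝ} (hu : AEStronglyMeasurable u) :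
    AEStronglyMeasurable (interp1 L N u) := by
  have hb (i : ℤ) : Measurable (basis1 L N i) :=
    ((measurable_hat _).comp (measurable_id.sub_const _)).indicator
      (measurableSet_Icc.inter measurableSet_Icc)
  have h1 : Measurable fun x => ∑ i ∈ Finset.Icc (0 : ℤ) N, u (node L N i) * basis1 L N i x := by
    fun_prop
  exact h1.aestronglyMeasurable.add (hu.indicator measurableSet_Icc.compl)

theorem abs_interp1_sub_le {α δ : ℝ} {u : ℝ → ℝ} (hα : 0 ≤ α) (hL : 0 < L) (hδ : 0 < δ)
    (hN : 0 < N) (hu : IsC1Holder α (box1 L δ) u) {y : ℝ} (hy : y ∈ dom1 L) :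
    |interp1 L N u y - u y| ≤
      (c1HolderNorm α (box1 L δ) u).toReal * (2 * mesh L N) ^ (1 + α) := by
  have hsub : Set.Icc (-L) L ⊆ box1 L δ := Set.Icc_subset_Ioo (by linarith) (by linarith)
  have hm := mesh_pos hL hN
  rw [interp1_of_mem hy]
  refine hu.abs_interpolation_le hα isOpen_Ioo (convex_Ioo _ _) (hsub hy) (fun i hi => ?_)
    (fun i _ => hat_nonneg _) (sum_hat hL hN hy) (sum_hat_mul_node_sub hL hN hy) fun i _ h => ?_
  · rw [Finset.mem_Icc] at hi
    exact hsub (node_mem_Icc hL hN hi.1 hi.2)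
  · rw [norm_sub_rev, Real.norm_eq_abs]
    linarith [abs_lt_of_hat_ne_zero h]

theorem isConsistent_one_dim :
    IsConsistent (fun _ : Unit => (1 : ℝ)) (fun _ : Unit => (1 : ℝ)) where
  sum_inner_sq z := by simp
  sum_norm_sq := by simp

theorem scheme1_eq_neg_discLap (s L : ℝ) (N : ℕ) (u : ℝ → ℝ) (i : ℤ) :
    scheme1 s L N u i = -discLap (fun _ : Unit => (1 : ℝ)) (fun _ : Unit => (1 : ℝ)) (mesh L N)
      (riesz (s - 1) (interp1 L N u)) (node L N i) := by
  simp only [scheme1, negLap1, riesz1, discLap, secondDiff, node_add_one, node_sub_one,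
    Finset.univ_unique, Finset.sum_singleton, smul_eq_mul, mul_one]
  ring

theorem node_add_mem_box1 {δ z : ℝ} (hL : 0 < L) (hN : 0 < N) {i : ℤ}
    (hi : i ∈ Set.Icc (0 : ℤ) N) (hz : |z| < δ) : node L N i + z ∈ box1 L δ := by
  have h := node_mem_Icc hL hN hi.1 hi.2
  rw [abs_lt] at hz
  constructor <;> linarith [h.1, h.2]

end OneDim

/-! ### Two dimensions -/

section TwoDim

variable {L : ℝ} {N : ℕ}

theorem dom2_box (x : Plane) : x ∈ dom2 L ↔ x 0 ∈ Set.Icc (-L) L ∧ x 1 ∈ Set.Icc (-L) L := by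
  simp [dom2, Fin.forall_fin_two]

theorem basis2_of_mem {x : Plane} (hx : x ∈ dom2 L) (i : ℤ × ℤ) :
    basis2 L N i x =
      hat (mesh L N) (x 0 - node L N i.1) * hat (mesh L N) (x 1 - node L N i.2) := by
  by_cases h0 : x 0 ∈ Set.Icc (node L N (i.1 - 1)) (node L N (i.1 + 1))
  · by_cases h1 : x 1 ∈ Set.Icc (node L N (i.2 - 1)) (node L N (i.2 + 1))
    · unfold basis2
      refine Set.indicator_of_mem ?_ _
      exact ⟨⟨h0, h1⟩, hx⟩
    · rw [basis2, Set.indicator_of_notMem fun h' => h1 h'.1.2, hat_eq_zero_of_notMem_Icc h1,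
        mul_zero]
  · rw [basis2, Set.indicator_of_notMem fun h' => h0 h'.1.1, hat_eq_zero_of_notMem_Icc h0,
      zero_mul]

theorem interp2_of_mem {x : Plane} (hx : x ∈ dom2 L) (u : Plane → ℝ) :
    interp2 L N u x = ∑ i ∈ Finset.Icc (0 : ℤ) N ×ˢ Finset.Icc (0 : ℤ) N, u (node2 L N i) *
      (hat (mesh L N) (x 0 - node L N i.1) * hat (mesh L N) (x 1 - node L N i.2)) := by
  simp only [interp2, basis2_of_mem hx]
  rw [Set.indicator_of_notMem (by simpa using hx), add_zero]

theorem interp2_of_notMem {x : Plane} (hx : x ∉ dom2 L) (u : Plane → ℝ) :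
    interp2 L N u x = u x := by
  have h (i : ℤ × ℤ) : basis2 L N i x = 0 := Set.indicator_of_notMem (fun h => hx h.2) _
  simp only [interp2, h, mul_zero, Finset.sum_const_zero, zero_add]
  exact Set.indicator_of_mem hx u

theorem isClosed_dom2 : IsClosed (dom2 L) := by
  have : dom2 L = ⋂ k, (fun x : Plane => x k) ⁻¹' Set.Icc (-L) L := by ext; simp [dom2]
  rw [this]
  exact isClosed_iInter fun k => isClosed_Icc.preimage (by fun_prop)

theorem aestronglyMeasurable_interp2 {u : Plane → ℝ} (hu : AEStronglyMeasurable u) :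
    AEStronglyMeasurable (interp2 L N u) := by
  have hcoord (k : Fin 2) : Measurable fun x : Plane => x k := by fun_prop
  have hb (i : ℤ × ℤ) : Measurable (basis2 L N i) := by
    refine Measurable.indicator ?_ ?_
    · exact ((measurable_hat _).comp ((hcoord 0).sub_const _)).mul
        ((measurable_hat _).comp ((hcoord 1).sub_const _))
    · exact ((hcoord 0 measurableSet_Icc).inter (hcoord 1 measurableSet_Icc)).inter
        isClosed_dom2.measurableSet
  have h1 : Measurable fun x => ∑ i ∈ Finset.Icc (0 : ℤ) N ×ˢ Finset.Icc (0 : ℤ) N,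
      u (node2 L N i) * basis2 L N i x := by
    fun_prop
  exact h1.aestronglyMeasurable.add (hu.indicator isClosed_dom2.measurableSet.compl)

theorem isOpen_box2 (L δ : ℝ) : IsOpen (box2 L δ) := by
  have : box2 L δ = ⋂ k, (fun x : Plane => x k) ⁻¹' Set.Ioo (-L - δ) (L + δ) := by
    ext; simp [box2]
  rw [this]
  exact isOpen_iInter_of_finite fun k => isOpen_Ioo.preimage (by fun_prop)

theorem convex_box2 (L δ : ℝ) : Convex ℝ (box2 L δ) := by
  intro x hx y hy a b ha hb hab k
  exact convex_Ioo (-L - δ) (L + δ) (hx k) (hy k) ha hb hab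

theorem isBounded_dom2 : Bornology.IsBounded (dom2 L) := by
  refine (Metric.isBounded_closedBall (x := (0 : Plane)) (r := Real.sqrt (L ^ 2 + L ^ 2))).subset
    fun x hx => ?_
  rw [mem_closedBall_zero_iff, EuclideanSpace.norm_eq, Fin.sum_univ_two]
  refine Real.sqrt_le_sqrt ?_
  have h (k : Fin 2) : ‖x k‖ ^ 2 ≤ L ^ 2 := by
    rw [Real.norm_eq_abs, sq_abs]
    exact sq_le_sq' (hx k).1 (hx k).2
  exact add_le_add (h 0) (h 1)

theorem node2_mem_dom2 (hL : 0 < L) (hN : 0 < N) {i : ℤ × ℤ} (h1 : i.1 ∈ Set.Icc (0 : ℤ) N)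
    (h2 : i.2 ∈ Set.Icc (0 : ℤ) N) : node2 L N i ∈ dom2 L := by
  rw [dom2_box]
  exact ⟨by simpa [node2] using node_mem_Icc hL hN h1.1 h1.2,
    by simpa [node2] using node_mem_Icc hL hN h2.1 h2.2⟩

theorem abs_interp2_sub_le {α δ : ℝ} {u : Plane → ℝ} (hα : 0 ≤ α) (hL : 0 < L) (hδ : 0 < δ)
    (hN : 0 < N) (hu : IsC1Holder α (box2 L δ) u) {y : Plane} (hy : y ∈ dom2 L) :
    |interp2 L N u y - u y| ≤
      (c1HolderNorm α (box2 L δ) u).toReal * (2 * mesh L N) ^ (1 + α) := by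
  have hsub : dom2 L ⊆ box2 L δ := fun x hx k =>
    Set.Icc_subset_Ioo (by linarith) (by linarith) (hx k)
  have hm := mesh_pos hL hN
  have hy' := (dom2_box y).1 hy
  have s0 := sum_hat hL hN hy'.1
  have s1 := sum_hat hL hN hy'.2
  have t0 := sum_hat_mul_node_sub hL hN hy'.1
  have t1 := sum_hat_mul_node_sub hL hN hy'.2
  rw [interp2_of_mem hy]
  refine hu.abs_interpolation_le hα (isOpen_box2 L δ) (convex_box2 L δ) (hsub hy) (fun i hi => ?_)
    (fun i _ => mul_nonneg (hat_nonneg _) (hat_nonneg _)) ?_ ?_ fun i _ h => ?_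
  · rw [Finset.mem_product, Finset.mem_Icc, Finset.mem_Icc] at hi
    exact hsub (node2_mem_dom2 hL hN hi.1 hi.2)
  · rw [Finset.sum_product]
    dsimp only
    rw [← Finset.sum_mul_sum, s0, s1, one_mul]
  · ext k
    fin_cases k
    · simp only [node2, Fin.zero_eta, Fin.isValue, PiLp.zero_apply, WithLp.ofLp_sum,
        Finset.sum_apply, PiLp.smul_apply, PiLp.sub_apply, smul_eq_mul, Matrix.cons_val_zero,
        mul_right_comm _ _ (node L N _ - y.ofLp 0)]
      rw [Finset.sum_product]
      dsimp only
      rw [← Finset.sum_mul_sum _ _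
        (fun i => hat (mesh L N) (y 0 - node L N i) * (node L N i - y 0)), t0, zero_mul]
    · simp only [node2, Fin.mk_one, Fin.isValue, PiLp.zero_apply, WithLp.ofLp_sum,
        Finset.sum_apply, PiLp.smul_apply, PiLp.sub_apply, smul_eq_mul, Matrix.cons_val_one,
        Matrix.cons_val_fin_one, mul_assoc]
      rw [Finset.sum_product]
      dsimp only
      rw [← Finset.sum_mul_sum _ _ _
        (fun j => hat (mesh L N) (y 1 - node L N j) * (node L N j - y 1)), t1, mul_zero]
  · have h0 := abs_lt_of_hat_ne_zero (left_ne_zero_of_mul h)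
    have h1 := abs_lt_of_hat_ne_zero (right_ne_zero_of_mul h)
    rw [norm_sub_rev, EuclideanSpace.norm_eq, Fin.sum_univ_two]
    refine Real.sqrt_le_iff.2 ⟨by positivity, ?_⟩
    have e0 : ‖(y - node2 L N i) 0‖ ^ 2 ≤ mesh L N ^ 2 := by
      simp only [node2, PiLp.sub_apply, Matrix.cons_val_zero, Real.norm_eq_abs]
      gcongr
    have e1 : ‖(y - node2 L N i) 1‖ ^ 2 ≤ mesh L N ^ 2 := by
      simp only [node2, PiLp.sub_apply, Matrix.cons_val_one, Matrix.cons_val_fin_one,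
        Real.norm_eq_abs]
      gcongr
    nlinarith

/-- The directions of the five-point stencil. -/
def axisDir : Fin 2 → Plane := ![!₂[1, 0], !₂[0, 1]]

/-- The directions of the diagonal stencil. -/
def diagDir : Fin 2 → Plane := ![!₂[1, 1], !₂[1, -1]]

theorem isConsistent_axisDir : IsConsistent (fun _ => (1 : ℝ)) axisDir where
  sum_inner_sq z := by
    rw [EuclideanSpace.norm_sq_eq]
    simp [axisDir, Fin.sum_univ_two, PiLp.inner_apply]
  sum_norm_sq := by
    simp only [EuclideanSpace.norm_sq_eq]
    simp [axisDir, Fin.sum_univ_two]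
    norm_num

theorem isConsistent_diagDir : IsConsistent (fun _ => (1 / 2 : ℝ)) diagDir where
  sum_inner_sq z := by
    rw [EuclideanSpace.norm_sq_eq]
    simp [diagDir, Fin.sum_univ_two, PiLp.inner_apply]
    ring
  sum_norm_sq := by
    simp only [EuclideanSpace.norm_sq_eq]
    simp [diagDir, Fin.sum_univ_two]
    norm_num

theorem negLap2a_eq_neg_discLap (L : ℝ) (N : ℕ) (f : Plane → ℝ) (i : ℤ × ℤ) :
    negLap2a (mesh L N) (fun i => f (node2 L N i)) i =
      -discLap (fun _ => (1 : ℝ)) axisDir (mesh L N) f (node2 L N i) := by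
  set h := mesh L N with hh
  have e1 : node2 L N i + h • axisDir 0 = node2 L N (i.1 + 1, i.2) := by
    ext k; fin_cases k <;> simp [node2, axisDir, node_add_one, hh]
  have e2 : node2 L N i - h • axisDir 0 = node2 L N (i.1 - 1, i.2) := by
    ext k; fin_cases k <;> simp [node2, axisDir, node_sub_one, hh]
  have e3 : node2 L N i + h • axisDir 1 = node2 L N (i.1, i.2 + 1) := by
    ext k; fin_cases k <;> simp [node2, axisDir, node_add_one, hh]
  have e4 : node2 L N i - h • axisDir 1 = node2 L N (i.1, i.2 - 1) := by
    ext k; fin_cases k <;> simp [node2, axisDir, node_sub_one, hh]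
  simp only [negLap2a, discLap, secondDiff, Fin.sum_univ_two, e1, e2, e3, e4]
  ring

theorem negLap2b_eq_neg_discLap (L : ℝ) (N : ℕ) (f : Plane → ℝ) (i : ℤ × ℤ) :
    negLap2b (mesh L N) (fun i => f (node2 L N i)) i =
      -discLap (fun _ => (1 / 2 : ℝ)) diagDir (mesh L N) f (node2 L N i) := by
  set h := mesh L N with hh
  have e1 : node2 L N i + h • diagDir 0 = node2 L N (i.1 + 1, i.2 + 1) := by
    ext k; fin_cases k <;> simp [node2, diagDir, node_add_one, hh]
  have e2 : node2 L N i - h • diagDir 0 = node2 L N (i.1 - 1, i.2 - 1) := by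
    ext k; fin_cases k <;> simp [node2, diagDir, node_sub_one, hh]
  have e3 : node2 L N i + h • diagDir 1 = node2 L N (i.1 + 1, i.2 - 1) := by
    ext k; fin_cases k <;> simp [node2, diagDir, node_add_one, node_sub_one, hh, ← sub_eq_add_neg]
  have e4 : node2 L N i - h • diagDir 1 = node2 L N (i.1 - 1, i.2 + 1) := by
    ext k; fin_cases k <;> simp [node2, diagDir, node_add_one, node_sub_one, hh]
  simp only [negLap2b, discLap, secondDiff, Fin.sum_univ_two, e1, e2, e3, e4]
  ring

theorem node2_add_mem_box2 {δ : ℝ} {z : Plane} (hL : 0 < L) (hN : 0 < N) {i : ℤ × ℤ}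
    (h1 : i.1 ∈ Set.Icc (0 : ℤ) N) (h2 : i.2 ∈ Set.Icc (0 : ℤ) N) (hz : ‖z‖ < δ) :
    node2 L N i + z ∈ box2 L δ := by
  intro k
  have h := node2_mem_dom2 hL hN h1 h2 k
  have hk : |z k| < δ := (PiLp.norm_apply_le z k).trans_lt hz
  rw [abs_lt] at hk
  constructor <;> simp only [PiLp.add_apply] <;> linarith [h.1, h.2]

end TwoDim

/-! ### Error bounds at the interior nodes -/

theorem card_interior1_le (N : ℕ) : (interior1 N).card ≤ N ^ 1 := by
  simp [interior1]

theorem card_interior2_le (N : ℕ) : (interior2 N).card ≤ N ^ 2 := by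
  rw [interior2, Finset.card_product, sq]
  have h : (Finset.Ioo 0 (N : ℤ)).card ≤ N := by simp
  gcongr

/-- The one-dimensional error bound at a single interior node. -/
theorem exists_error1_bound {s α L δ : ℝ} (hs : 0 < s) (hs1 : s < 1) (hs2 : s ≠ 1 / 2)
    (hα0 : 0 < α) (hα : 2 * s - 1 < α) (hα1 : α ≤ 1) (hL : 0 < L) (hδ : 0 < δ) :
    ∃ C : ℝ, 0 ≤ C ∧ ∀ (N : ℕ) (u : ℝ → ℝ), 0 < N → MemLp u ⊤ volume → HasCompactSupport u →
      IsC1Holder α (box1 L δ) u → ∀ i ∈ interior1 N,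
        HasFracLap s u (node L N i) (fracLap s u (node L N i)) ∧
        |error1 s L N u i| ≤ C * dataNorm α (box1 L δ) u * mesh L N ^ (1 + α - 2 * s) := by
  have hn : (Module.finrank ℝ ℝ : ℝ) / 2 + (s - 1) ≠ 0 := fun h => hs2 (by
    rw [Module.finrank_self, Nat.cast_one] at h; linarith)
  obtain ⟨C, hC, h⟩ := exists_scheme_error_bound isConsistent_one_dim hs hs1 hn hα0 hα hα1 hδ
  refine ⟨C, hC, fun N u hN hm hcs hu i hi => ?_⟩
  have hi' : i ∈ Set.Icc (0 : ℤ) N := Set.Ioo_subset_Icc_self (by simpa [interior1] using hi)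
  rw [error1, scheme1_eq_neg_discLap]
  exact h (mesh L N) (dom1 L) (box1 L δ) u (interp1 L N u) (node L N i) (mesh_pos hL hN)
    isOpen_Ioo (convex_Ioo _ _) hu hm hcs (fun z hz => node_add_mem_box1 hL hN hi' hz)
    (aestronglyMeasurable_interp1 hm.1) (Metric.isBounded_Icc _ _)
    (fun y hy => abs_interp1_sub_le hα0.le hL hδ hN hu hy) fun y hy => interp1_of_notMem hy u

/-- The two-dimensional error bound at a single interior node; the scheme is a convex combination
of the five-point and the diagonal scheme, so its error is at most the larger of theirs. -/
theorem exists_error2_bound {s α L δ : ℝ} (hs : 0 < s) (hs1 : s < 1)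
    (hα0 : 0 < α) (hα : 2 * s - 1 < α) (hα1 : α ≤ 1) (hL : 0 < L) (hδ : 0 < δ) :
    ∃ C : ℝ, 0 ≤ C ∧ ∀ (N : ℕ) (θ : ℝ) (u : Plane → ℝ), 0 < N → θ ∈ Set.Icc (0 : ℝ) 1 →
      MemLp u ⊤ volume → HasCompactSupport u → IsC1Holder α (box2 L δ) u → ∀ i ∈ interior2 N,
        HasFracLap s u (node2 L N i) (fracLap s u (node2 L N i)) ∧
        |error2 s θ L N u i| ≤ C * dataNorm α (box2 L δ) u * mesh L N ^ (1 + α - 2 * s) := by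
  have hn : (Module.finrank ℝ Plane : ℝ) / 2 + (s - 1) ≠ 0 := by
    rw [finrank_euclideanSpace_fin]
    intro h
    push_cast at h
    linarith
  obtain ⟨C₁, hC₁, h₁⟩ := exists_scheme_error_bound isConsistent_axisDir hs hs1 hn hα0 hα hα1 hδ
  obtain ⟨C₂, hC₂, h₂⟩ := exists_scheme_error_bound isConsistent_diagDir hs hs1 hn hα0 hα hα1 hδ
  refine ⟨C₁ + C₂, by positivity, fun N θ u hN hθ hm hcs hu i hi => ?_⟩
  simp only [interior2, Finset.mem_product, Finset.mem_Ioo] at hi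
  have hi1 : i.1 ∈ Set.Icc (0 : ℤ) N := ⟨hi.1.1.le, hi.1.2.le⟩
  have hi2 : i.2 ∈ Set.Icc (0 : ℤ) N := ⟨hi.2.1.le, hi.2.2.le⟩
  have hx (z : Plane) (hz : ‖z‖ < δ) := node2_add_mem_box2 hL hN hi1 hi2 hz
  have hv := aestronglyMeasurable_interp2 (L := L) (N := N) hm.1
  have hD (y : Plane) (hy : y ∈ dom2 L) := abs_interp2_sub_le hα0.le hL hδ hN hu hy
  have hD' (y : Plane) (hy : y ∉ dom2 L) := interp2_of_notMem (N := N) hy u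
  obtain ⟨hlap, e₁⟩ := h₁ (mesh L N) (dom2 L) (box2 L δ) u (interp2 L N u) (node2 L N i)
    (mesh_pos hL hN) (isOpen_box2 L δ) (convex_box2 L δ) hu hm hcs hx hv isBounded_dom2 hD hD'
  obtain ⟨-, e₂⟩ := h₂ (mesh L N) (dom2 L) (box2 L δ) u (interp2 L N u) (node2 L N i)
    (mesh_pos hL hN) (isOpen_box2 L δ) (convex_box2 L δ) hu hm hcs hx hv isBounded_dom2 hD hD'
  refine ⟨hlap, ?_⟩
  rw [← negLap2a_eq_neg_discLap] at e₁
  rw [← negLap2b_eq_neg_discLap] at e₂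
  have hθ' : 0 ≤ 1 - θ := sub_nonneg.2 hθ.2
  set l := fracLap s u (node2 L N i)
  set T := dataNorm α (box2 L δ) u * mesh L N ^ (1 + α - 2 * s) with hT
  have hT0 : 0 ≤ T := mul_nonneg (dataNorm_nonneg _ _ _)
    (Real.rpow_nonneg (mesh_pos hL hN).le _)
  rw [mul_assoc, ← hT] at e₁ e₂ ⊢
  have key : error2 s θ L N u i =
      θ * (l - negLap2a (mesh L N) (riesz2 s L N u) i) +
        (1 - θ) * (l - negLap2b (mesh L N) (riesz2 s L N u) i) := by
    rw [error2, scheme2]; ring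
  rw [key]
  calc _ ≤ θ * (C₁ * T) + (1 - θ) * (C₂ * T) := by
        refine (abs_add_le _ _).trans ?_
        rw [abs_mul, abs_mul, abs_of_nonneg hθ.1, abs_of_nonneg hθ']
        exact add_le_add (mul_le_mul_of_nonneg_left e₁ hθ.1) (mul_le_mul_of_nonneg_left e₂ hθ')
    _ ≤ 1 * (C₁ * T) + 1 * (C₂ * T) := by
        have := hθ.2
        have := hθ.1
        gcongr
        linarith
    _ = _ := by ring

end FracFD

end

theorem mainTheorem1 (s α L δ : ℝ)
    (hs : s ∈ Set.Ioo (0 : ℝ) (1 / 2) ∪ Set.Ioo (1 / 2 : ℝ) 1)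
    (hα : α ∈ Set.Ioc (max 0 (2 * s - 1)) 1) (hL : 0 < L) (hδ : 0 < δ) :
    (∃ C : ℝ, 0 < C ∧ ∀ (N : ℕ) (u : ℝ → ℝ), 0 < N → 4 * FracFD.mesh L N < δ →
      MemLp u ⊤ volume → HasCompactSupport u → FracFD.IsC1Holder α (FracFD.box1 L δ) u →
        (∀ i ∈ FracFD.interior1 N,
          FracFD.HasFracLap s u (FracFD.node L N i) (FracFD.fracLap s u (FracFD.node L N i))) ∧
        FracFD.gridSupNorm (FracFD.interior1 N) (FracFD.error1 s L N u)
          ≤ C * FracFD.dataNorm α (FracFD.box1 L δ) u * FracFD.mesh L N ^ (1 + α - 2 * s) ∧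
        FracFD.gridL2Norm 1 (FracFD.mesh L N) (FracFD.interior1 N) (FracFD.error1 s L N u)
          ≤ C * FracFD.dataNorm α (FracFD.box1 L δ) u * FracFD.mesh L N ^ (1 + α - 2 * s)) ∧
    (∃ C : ℝ, 0 < C ∧ ∀ (N : ℕ) (θ : ℝ) (u : FracFD.Plane → ℝ), 0 < N →
      4 * FracFD.mesh L N < δ → θ ∈ Set.Icc (0 : ℝ) 1 →
      MemLp u ⊤ volume → HasCompactSupport u → FracFD.IsC1Holder α (FracFD.box2 L δ) u →
        (∀ i ∈ FracFD.interior2 N,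
          FracFD.HasFracLap s u (FracFD.node2 L N i) (FracFD.fracLap s u (FracFD.node2 L N i))) ∧
        FracFD.gridSupNorm (FracFD.interior2 N) (FracFD.error2 s θ L N u)
          ≤ C * FracFD.dataNorm α (FracFD.box2 L δ) u * FracFD.mesh L N ^ (1 + α - 2 * s) ∧
        FracFD.gridL2Norm 2 (FracFD.mesh L N) (FracFD.interior2 N) (FracFD.error2 s θ L N u)
          ≤ C * FracFD.dataNorm α (FracFD.box2 L δ) u * FracFD.mesh L N ^ (1 + α - 2 * s)) := by
  have hs0 : 0 < s := hs.elim (fun h => h.1) fun h => by linarith [h.1]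
  have hs1 : s < 1 := hs.elim (fun h => by linarith [h.2]) fun h => h.2
  have hs2 : s ≠ 1 / 2 := hs.elim (fun h => h.2.ne) fun h => h.1.ne'
  obtain ⟨hα0, hα2⟩ := max_lt_iff.1 hα.1
  constructor
  · obtain ⟨C, hC, h⟩ := FracFD.exists_error1_bound hs0 hs1 hs2 hα0 hα2 hα.2 hL hδ
    -- `C` may vanish, so `C + 1` gives a positive constant.
    refine ⟨(1 + Real.sqrt ((2 * L) ^ 1)) * (C + 1), by positivity, ?_⟩
    intro N u hN _ hm hcs hu
    have hT : 0 ≤ FracFD.dataNorm α (FracFD.box1 L δ) u * FracFD.mesh L N ^ (1 + α - 2 * s) :=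
      mul_nonneg (FracFD.dataNorm_nonneg _ _ _) (Real.rpow_nonneg (FracFD.mesh_pos hL hN).le _)
    have h2 := FracFD.grid_norms_le (err := FracFD.error1 s L N u) hL hN
      (mul_nonneg (by linarith : 0 ≤ C + 1) hT) (FracFD.card_interior1_le N) fun i hi =>
        (h N u hN hm hcs hu i hi).2.trans (by rw [mul_assoc]; gcongr; linarith)
    simp only [← mul_assoc] at h2
    exact ⟨fun i hi => (h N u hN hm hcs hu i hi).1, h2⟩
  · obtain ⟨C, hC, h⟩ := FracFD.exists_error2_bound hs0 hs1 hα0 hα2 hα.2 hL hδ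
    refine ⟨(1 + Real.sqrt ((2 * L) ^ 2)) * (C + 1), by positivity, ?_⟩
    intro N θ u hN _ hθ hm hcs hu
    have hT : 0 ≤ FracFD.dataNorm α (FracFD.box2 L δ) u * FracFD.mesh L N ^ (1 + α - 2 * s) :=
      mul_nonneg (FracFD.dataNorm_nonneg _ _ _) (Real.rpow_nonneg (FracFD.mesh_pos hL hN).le _)
    have h2 := FracFD.grid_norms_le (err := FracFD.error2 s θ L N u) hL hN
      (mul_nonneg (by linarith : 0 ≤ C + 1) hT) (FracFD.card_interior2_le N) fun i hi =>
        (h N θ u hN hθ hm hcs hu i hi).2.trans (by rw [mul_assoc]; gcongr; linarith)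
    simp only [← mul_assoc] at h2
    exact ⟨fun i hi => (h N θ u hN hθ hm hcs hu i hi).1, h2⟩
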